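/- Let $\mathbb R\langle x\rangle$ be the algebra of real polynomials in $g$ freely non-commuting variables $x=(x_1,\dots,x_g)$, with the involution $*$ that is the identity on scalars and satisfies $x_j^*=x_j$ and $(fh)^*=h^*f^*$. For $n\in\mathbb N$ let $\mathbb S_n$ be the space of real symmetric $n\times n$ matrices and $\mathbb S_n(\mathbb R^g)$ the space of $g$-tuples $X=(X_1,\dots,X_g)$ of matrices in $\mathbb S_n$; $f(X)$ denotes the evaluation of a polynomial $f$ at $X$, and $\succ 0$ and $\succeq 0$ mean positive definite and positive semidefinite. Call $f$ a (hermitian) sum of squares if $f=\sum_{j=1}^m h_j^*h_j$ for finitely many $h_j\in\mathbb R\langle x\rangle$, and call $f$ linear if it is a real linear combination of $x_1,\dots,x_g$. Let $p\in\mathbb R\langle x\rangle$ be quasi-convex, that is, $p=p^*$, $p(0)=0$, and for every $n$ and every positive definite $A\in\mathbb S_n$ the set $\{X\in\mathbb S_n(\mathbb R^g): A-p(X)\succ 0\}$ is convex. Then: 1. Either $-p$ is a sum of squares, or $p$ has degree at most $2$ and there are a linear polynomial $\ell$ and finitely many linear polynomials $s_1,\dots,s_m$ with $$p=\ell+\sum_{j=1}^m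 s_j^*s_j .$$ (The two alternatives are not claimed to exclude each other.) 2. If there is an $N$ such that for each $n\ge N$ there is a $B\in\mathbb S_n$ with $B\not\succeq 0$ for which $\{X\in\mathbb S_n(\mathbb R^g): B-p(X)\succ 0\}$ is convex, then $-p$ is a sum of squares if and only if $p=0$. -/

import Mathlib

noncomputable section

namespace FreePoly

/-- Free polynomials over `ℝ` in the freely non-commuting variables `x_1, …, x_g`. Mathlib's `star`
on `FreeAlgebra` is the involution which fixes every variable and every scalar and reverses
products. -/
abbrev Poly (g : ℕ) : Type := FreeAlgebra ℝ (Fin g)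

/-- The `g`-tuples of real symmetric `n × n` matrices. -/
def symTuples (g n : ℕ) : Set (Fin g → Matrix (Fin n) (Fin n) ℝ) :=
  {X | ∀ j, (X j).IsSymm}

/-- The evaluation `p(X)` of a free polynomial at a tuple of matrices. -/
def eval {g n : ℕ} (X : Fin g → Matrix (Fin n) (Fin n) ℝ) (p : Poly g) :
    Matrix (Fin n) (Fin n) ℝ :=
  FreeAlgebra.lift ℝ X p

/-- The set `{X : A - p(X) ≻ 0}` of tuples of symmetric matrices. -/
def levelSet {g n : ℕ} (p : Poly g) (A : Matrix (Fin n) (Fin n) ℝ) :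
    Set (Fin g → Matrix (Fin n) (Fin n) ℝ) :=
  {X | X ∈ symTuples g n ∧ (A - eval X p).PosDef}

/-- A free polynomial `p` is quasi-convex if it is symmetric, `p(0) = 0`, and `{X : A - p(X) ≻ 0}`
is convex for every positive definite matrix `A` of every size. -/
structure IsQuasiConvex {g : ℕ} (p : Poly g) : Prop where
  symmetric : star p = p
  eval_zero : ∀ n : ℕ, eval (0 : Fin g → Matrix (Fin n) (Fin n) ℝ) p = 0
  convex : ∀ (n : ℕ) (A : Matrix (Fin n) (Fin n) ℝ), A.PosDef → Convex ℝ (levelSet p A)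

/-- Hermitian sums of squares `∑ h_j^* h_j`. -/
def IsHermitianSOS {g : ℕ} (p : Poly g) : Prop :=
  ∃ (m : ℕ) (h : Fin m → Poly g), p = ∑ j, star (h j) * h j

/-- Linear polynomials: the real linear combinations of the variables (no constant term). -/
def IsLinear {g : ℕ} (p : Poly g) : Prop :=
  p ∈ Submodule.span ℝ (Set.range (FreeAlgebra.ι ℝ : Fin g → Poly g))

/-- The degree of a free polynomial: the largest length of a word with nonzero coefficient
(and `0` for the zero polynomial). -/
def degree {g : ℕ} (p : Poly g) : ℕ :=
  (FreeAlgebra.equivMonoidAlgebraFreeMonoid (R := ℝ) (X := Fin g) p).coeff.support.sup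
    FreeMonoid.length

end FreePoly

end

/-! Testing against one vector `v` makes quasi-convexity scalar: with `A` of quadratic form `c > 0`
at `v` and huge on the complement of `v`, the sets `⟨p(X)v, v⟩ < c` turn out midpoint convex
(`form_midpoint_lt`).

Suppose `c = ⟨p(X)v, v⟩ > 0` somewhere. Bordering `X` by a row and column `±t b` changes this value
by `q t² + O(t³)`, while the midpoint of the two bordered tuples gives `c` back, so `q ≥ 0`
(`secondOrder_nonneg`). Here `q` is quadratic in the numbers `⟨b_j, m(X)v⟩`, `m` a word. These are
arbitrary once the vectors `m(X)v` are independent, which adding a small piece of a truncated Fock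
space ensures. A top word of length at least three would then contribute an off-diagonal term with
vanishing diagonal partner, which is unbounded below. So the degree is at most two, and `q ≥ 0` says
that the matrix of quadratic coefficients is positive semidefinite.

If no value is positive, `-p` is a sum of squares by a separating functional and a truncated GNS
construction (`isHermitianSOS_of_nonneg`).

For the second claim, let `-p = ∑ h_j^* h_j` be nonzero. As `p(0) = 0`, some `h_k` is nonconstant,
and its leading part is invertible at some tuple `Y` (`exists_isUnit_evalOn`). Then `B - p(±Y/s)` is
positive definite for small `s`, so by convexity `B - p(0) = B` is too, a contradiction. -/

noncomputable section
namespace FreePoly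
open Matrix

/-! ### Words, coefficients and evaluations. -/

variable {g : ℕ}

/-- The monomial attached to a word in the variables. -/
def word (l : List (Fin g)) : Poly g := (l.map (FreeAlgebra.ι ℝ)).prod

@[simp] theorem word_nil : word ([] : List (Fin g)) = 1 := rfl

@[simp] theorem word_cons (j : Fin g) (l : List (Fin g)) :
    word (j :: l) = FreeAlgebra.ι ℝ j * word l := by
  simp [word]

theorem word_append (l m : List (Fin g)) : word (l ++ m) = word l * word m := by
  simp [word]

theorem star_word (l : List (Fin g)) : star (word l) = word l.reverse := by
  induction l with
  | nil => simp
  | cons j l ih => simp [word_append, ih]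

theorem star_smul_poly (c : ℝ) (q : Poly g) : star (c • q) = c • star q := by
  rw [Algebra.smul_def, star_mul, FreeAlgebra.star_algebraMap, Algebra.smul_def,
    Algebra.commutes]

/-- The coefficient of a word in a free polynomial. -/
def coef (l : List (Fin g)) : Poly g →ₗ[ℝ] ℝ where
  toFun p := (FreeAlgebra.equivMonoidAlgebraFreeMonoid (R := ℝ) (X := Fin g) p).coeff
    (FreeMonoid.ofList l)
  map_add' p q := by simp
  map_smul' c p := by simp

/-- The words which occur in a free polynomial. -/
def supp (p : Poly g) : Finset (List (Fin g)) :=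
  (FreeAlgebra.equivMonoidAlgebraFreeMonoid (R := ℝ) (X := Fin g) p).coeff.support

theorem mem_supp {p : Poly g} {l : List (Fin g)} : l ∈ supp p ↔ coef l p ≠ 0 :=
  Finsupp.mem_support_iff

theorem equiv_word (l : List (Fin g)) :
    FreeAlgebra.equivMonoidAlgebraFreeMonoid (R := ℝ) (X := Fin g) (word l) =
      MonoidAlgebra.single (FreeMonoid.ofList l) 1 := by
  induction l with
  | nil => simp [MonoidAlgebra.one_def]
  | cons j l ih =>
    rw [word_cons, map_mul, ih, FreeMonoid.ofList_cons]
    simp [FreeAlgebra.equivMonoidAlgebraFreeMonoid, MonoidAlgebra.of_apply,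
      MonoidAlgebra.single_mul_single]

theorem coef_word (l m : List (Fin g)) : coef l (word m) = if l = m then 1 else 0 := by
  simp only [coef, LinearMap.coe_mk, AddHom.coe_mk, equiv_word, MonoidAlgebra.coeff_single]
  by_cases h : l = m
  · rw [h, if_pos rfl, Finsupp.single_eq_same]
  · rw [if_neg h, Finsupp.single_eq_of_ne]
    exact fun h' => h (FreeMonoid.ofList.injective h')

theorem sum_coef_word (p : Poly g) : ∑ l ∈ supp p, coef l p • word l = p := by
  apply (FreeAlgebra.equivMonoidAlgebraFreeMonoid (R := ℝ) (X := Fin g)).injective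
  rw [map_sum]
  simp only [map_smul, equiv_word]
  conv_rhs => rw [← MonoidAlgebra.sum_coeff_single
    (FreeAlgebra.equivMonoidAlgebraFreeMonoid (R := ℝ) (X := Fin g) p)]
  rw [Finsupp.sum]
  refine Finset.sum_congr rfl fun l _ => ?_
  rw [MonoidAlgebra.smul_single, smul_eq_mul, mul_one]
  rfl

theorem poly_ext {p q : Poly g} (h : ∀ l, coef l p = coef l q) : p = q := by
  have hs : supp p = supp q := by ext l; rw [mem_supp, mem_supp, h]
  rw [← sum_coef_word p, ← sum_coef_word q, hs]
  simp only [h]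

theorem coef_star (l : List (Fin g)) (p : Poly g) : coef l (star p) = coef l.reverse p := by
  rw [← sum_coef_word p, star_sum, map_sum, map_sum]
  refine Finset.sum_congr rfl fun m _ => ?_
  rw [star_smul_poly, star_word, map_smul, map_smul, coef_word, coef_word]
  congr 2
  rw [eq_iff_iff]
  exact List.reverse_eq_iff.symm

theorem length_le_degree {p : Poly g} {l : List (Fin g)} (h : coef l p ≠ 0) :
    l.length ≤ degree p :=
  Finset.le_sup (f := FreeMonoid.length) (mem_supp.2 h)

theorem coef_eq_zero_of_degree_lt {p : Poly g} {l : List (Fin g)} (h : degree p < l.length) :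
    coef l p = 0 := by
  by_contra h0
  exact absurd (length_le_degree h0) (by omega)

theorem exists_coef_ne_zero_of_degree_pos {p : Poly g} (h : 0 < degree p) :
    ∃ l : List (Fin g), coef l p ≠ 0 ∧ l.length = degree p := by
  have hne : (supp p).Nonempty := by
    rw [Finset.nonempty_iff_ne_empty]
    intro h0
    have : degree p = 0 := by
      unfold degree
      unfold supp at h0
      rw [h0]; rfl
    omega
  obtain ⟨l, hl, hl2⟩ := Finset.exists_mem_eq_sup (supp p) hne FreeMonoid.length
  exact ⟨l, mem_supp.1 hl, hl2.symm⟩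

/-- Evaluation of free polynomials at tuples of matrices with an arbitrary finite index type. -/
def evalOn {ι : Type*} [Fintype ι] [DecidableEq ι] (X : Fin g → Matrix ι ι ℝ) :
    Poly g →ₐ[ℝ] Matrix ι ι ℝ :=
  FreeAlgebra.lift ℝ X

section evalOn

variable {ι κ : Type*} [Fintype ι] [DecidableEq ι] [Fintype κ] [DecidableEq κ]

theorem eval_eq_evalOn {n : ℕ} (X : Fin g → Matrix (Fin n) (Fin n) ℝ) (p : Poly g) :
    eval X p = evalOn X p := rfl

@[simp] theorem evalOn_ι (X : Fin g → Matrix ι ι ℝ) (j : Fin g) :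
    evalOn X (FreeAlgebra.ι ℝ j) = X j := by
  simp [evalOn]

theorem evalOn_eq_sum (X : Fin g → Matrix ι ι ℝ) (p : Poly g) :
    evalOn X p = ∑ l ∈ supp p, coef l p • evalOn X (word l) := by
  conv_lhs => rw [← sum_coef_word p]
  simp

theorem evalOn_word_star {X : Fin g → Matrix ι ι ℝ} (hX : ∀ j, (X j).IsSymm)
    (l : List (Fin g)) : (evalOn X (word l))ᵀ = evalOn X (word l.reverse) := by
  induction l with
  | nil => simp
  | cons j l ih => simp [word_append, ih, (hX j).eq]

theorem evalOn_star {X : Fin g → Matrix ι ι ℝ} (hX : ∀ j, (X j).IsSymm) (p : Poly g) :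
    evalOn X (star p) = (evalOn X p)ᵀ := by
  rw [← sum_coef_word p]
  simp only [star_sum, star_smul_poly, star_word, map_sum, map_smul, transpose_sum,
    transpose_smul, evalOn_word_star hX]

theorem evalOn_isSymm {X : Fin g → Matrix ι ι ℝ} (hX : ∀ j, (X j).IsSymm) {p : Poly g}
    (hp : star p = p) : (evalOn X p).IsSymm := by
  rw [IsSymm, ← evalOn_star hX, hp]

theorem map_evalOn (φ : Matrix ι ι ℝ →ₐ[ℝ] Matrix κ κ ℝ) (X : Fin g → Matrix ι ι ℝ)
    (p : Poly g) : φ (evalOn X p) = evalOn (fun j => φ (X j)) p := by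
  have : (φ.comp (evalOn X)) = evalOn (fun j => φ (X j)) := by
    apply FreeAlgebra.hom_ext
    ext1 j
    simp
  rw [← this]; rfl

theorem reindex_evalOn (e : ι ≃ κ) (X : Fin g → Matrix ι ι ℝ) (p : Poly g) :
    (evalOn X p).submatrix e.symm e.symm = evalOn (fun j => (X j).submatrix e.symm e.symm) p :=
  map_evalOn (reindexAlgEquiv ℝ ℝ e).toAlgHom X p

end evalOn

end FreePoly
end

/-! ### Scalarising quasi-convexity by barrier matrices. -/

noncomputable section
namespace FreePoly
open Matrix
variable {g : ℕ} {ι : Type*} [Fintype ι] [DecidableEq ι]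

theorem zero_le_dotProduct_self {ι : Type*} [Fintype ι] (v : ι → ℝ) : 0 ≤ v ⬝ᵥ v :=
  Finset.sum_nonneg fun _ _ => mul_self_nonneg _

open scoped MatrixOrder in
theorem exists_eq_transpose_mul_self {M : Matrix ι ι ℝ} (hM : M.PosSemidef) :
    ∃ S : Matrix ι ι ℝ, M = Sᵀ * S := by
  obtain ⟨S, hS⟩ := CStarAlgebra.nonneg_iff_eq_star_mul_self.mp hM.nonneg
  exact ⟨S, by rwa [star_eq_conjTranspose, conjTranspose_eq_transpose_of_trivial] at hS⟩

theorem exists_dotProduct_mulVec_le (M : Matrix ι ι ℝ) :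
    ∃ C : ℝ, 0 ≤ C ∧ ∀ x y : ι → ℝ, |x ⬝ᵥ M *ᵥ y| ≤ C * (√(x ⬝ᵥ x) * √(y ⬝ᵥ y)) := by
  refine ⟨‖(toEuclideanLin M).toContinuousLinearMap‖, norm_nonneg _, fun x y => ?_⟩
  have hn : ∀ z : ι → ℝ, ‖WithLp.toLp 2 z‖ = √(z ⬝ᵥ z) := by
    intro z
    rw [EuclideanSpace.norm_eq, dotProduct]
    simp [sq]
  have h1 := abs_real_inner_le_norm (WithLp.toLp 2 x)
    ((toEuclideanLin M).toContinuousLinearMap (WithLp.toLp 2 y))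
  have h2 := (toEuclideanLin M).toContinuousLinearMap.le_opNorm (WithLp.toLp 2 y)
  have h3 : inner ℝ (WithLp.toLp 2 x)
      ((toEuclideanLin M).toContinuousLinearMap (WithLp.toLp 2 y)) = x ⬝ᵥ M *ᵥ y := by
    simp [EuclideanSpace.inner_eq_star_dotProduct, dotProduct_comm]
  rw [h3, hn x] at h1
  rw [hn y] at h2
  calc |x ⬝ᵥ M *ᵥ y| ≤ _ := h1
    _ ≤ √(x ⬝ᵥ x) * (‖(toEuclideanLin M).toContinuousLinearMap‖ * √(y ⬝ᵥ y)) := by gcongr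
    _ = _ := by ring

/-- The matrix which acts as multiplication by `K` on the orthogonal complement of `v` and whose
quadratic form takes the value `c` at `v`. -/
def barrier (v : ι → ℝ) (c K : ℝ) : Matrix ι ι ℝ :=
  K • 1 + ((c - K * (v ⬝ᵥ v)) / (v ⬝ᵥ v) ^ 2) • vecMulVec v v

theorem barrier_isSymm (v : ι → ℝ) (c K : ℝ) : (barrier v c K).IsSymm := by
  simp [barrier, IsSymm, transpose_vecMulVec]

theorem dotProduct_barrier_mulVec (v x : ι → ℝ) (c K : ℝ) :
    x ⬝ᵥ barrier v c K *ᵥ x =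
      K * (x ⬝ᵥ x) + (c - K * (v ⬝ᵥ v)) / (v ⬝ᵥ v) ^ 2 * (x ⬝ᵥ v) ^ 2 := by
  simp only [barrier, add_mulVec, smul_mulVec, one_mulVec, dotProduct_add, dotProduct_smul,
    vecMulVec_mulVec, smul_eq_mul]
  simp only [dotProduct_comm v x, smul_eq_mul,
    op_smul_eq_smul]
  ring

theorem dotProduct_barrier_mulVec_self {v : ι → ℝ} (hv : v ≠ 0) (c K : ℝ) :
    v ⬝ᵥ barrier v c K *ᵥ v = c := by
  have hs : v ⬝ᵥ v ≠ 0 := by simpa using hv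
  rw [dotProduct_barrier_mulVec]
  field_simp
  ring

/-- For `x = α v + u` with `u ⟂ v` the form is `δ α² - 2α⟨v, M u⟩ + K‖u‖² - ⟨u, M u⟩` with `δ > 0`;
a large `K` absorbs the last term and, after completing the square in `α`, the cross term. Every
larger `K` works as well, so one barrier can serve several `M`. -/
theorem exists_posDef_barrier_sub {M : Matrix ι ι ℝ} (hM : M.IsSymm) {v : ι → ℝ} (hv : v ≠ 0)
    {c : ℝ} (h : v ⬝ᵥ M *ᵥ v < c) : ∃ K₀ : ℝ, ∀ K ≥ K₀, (barrier v c K - M).PosDef := by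
  obtain ⟨C, hC, hb⟩ := exists_dotProduct_mulVec_le M
  have hs : 0 < v ⬝ᵥ v := lt_of_le_of_ne (zero_le_dotProduct_self v) (Ne.symm (by simpa using hv))
  set s := v ⬝ᵥ v with hsdef
  set δ := c - v ⬝ᵥ M *ᵥ v with hδ
  have hδ0 : 0 < δ := by simp only [hδ]; linarith
  -- `C` pays for `⟨u, M u⟩`, `C² s / δ` for the cross term, and `1` keeps the inequality strict.
  refine ⟨C + (C ^ 2 * s) / δ + 1, fun K hK => ?_⟩
  refine PosDef.of_dotProduct_mulVec_pos ?_ fun x hx => ?_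
  · rw [IsHermitian, conjTranspose_eq_transpose_of_trivial, transpose_sub, (barrier_isSymm v c K).eq,
      hM.eq]
  obtain ⟨α, u, hxu, huv⟩ : ∃ (α : ℝ) (u : ι → ℝ), x = α • v + u ∧ u ⬝ᵥ v = 0 := by
    refine ⟨x ⬝ᵥ v / s, x - (x ⬝ᵥ v / s) • v, by simp, ?_⟩
    rw [sub_dotProduct, smul_dotProduct, ← hsdef, smul_eq_mul]
    field_simp
    ring
  have huv' : v ⬝ᵥ u = 0 := by rw [dotProduct_comm, huv]
  have hsym : u ⬝ᵥ M *ᵥ v = v ⬝ᵥ M *ᵥ u := by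
    rw [dotProduct_mulVec, ← mulVec_transpose, hM.eq, dotProduct_comm]
  have e1 : x ⬝ᵥ x = α ^ 2 * s + u ⬝ᵥ u := by
    simp [hxu, add_dotProduct, dotProduct_add, huv, huv', ← hsdef]; ring
  have e2 : x ⬝ᵥ v = α * s := by
    simp [hxu, add_dotProduct, huv, ← hsdef]
  have e3 : x ⬝ᵥ M *ᵥ x = α ^ 2 * (v ⬝ᵥ M *ᵥ v) + 2 * α * (v ⬝ᵥ M *ᵥ u) + u ⬝ᵥ M *ᵥ u := by
    simp [hxu, add_dotProduct, dotProduct_add, mulVec_add, mulVec_smul, hsym]; ring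
  have e4 : x ⬝ᵥ barrier v c K *ᵥ x = K * (u ⬝ᵥ u) + c * α ^ 2 := by
    rw [dotProduct_barrier_mulVec, e1, e2, ← hsdef]
    field_simp
    ring
  have e5 : star x ⬝ᵥ (barrier v c K - M) *ᵥ x =
      δ * α ^ 2 - 2 * α * (v ⬝ᵥ M *ᵥ u) + (K * (u ⬝ᵥ u) - u ⬝ᵥ M *ᵥ u) := by
    rw [star_trivial, sub_mulVec, dotProduct_sub, e3, e4, hδ]; ring
  rw [e5]
  have hu0 : 0 ≤ u ⬝ᵥ u := zero_le_dotProduct_self u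
  have b1 : u ⬝ᵥ M *ᵥ u ≤ C * (u ⬝ᵥ u) := by
    refine (le_abs_self _).trans ((hb u u).trans_eq ?_)
    rw [Real.mul_self_sqrt hu0]
  have b2 : (v ⬝ᵥ M *ᵥ u) ^ 2 ≤ C ^ 2 * s * (u ⬝ᵥ u) := by
    have := hb v u
    rw [← hsdef] at this
    calc (v ⬝ᵥ M *ᵥ u) ^ 2 = |v ⬝ᵥ M *ᵥ u| ^ 2 := (sq_abs _).symm
      _ ≤ (C * (√s * √(u ⬝ᵥ u))) ^ 2 := by gcongr
      _ = _ := by rw [mul_pow, mul_pow, Real.sq_sqrt hs.le, Real.sq_sqrt hu0]; ring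
  have b3 : (C + (C ^ 2 * s) / δ + 1) * (u ⬝ᵥ u) ≤ K * (u ⬝ᵥ u) := by gcongr
  set m := v ⬝ᵥ M *ᵥ u
  have b4 : m ^ 2 / δ ≤ C ^ 2 * s / δ * (u ⬝ᵥ u) := by
    rw [div_mul_eq_mul_div]; gcongr
  have b5 : δ * α ^ 2 - 2 * α * m + m ^ 2 / δ = δ * (α - m / δ) ^ 2 := by
    field_simp; ring
  rcases hu0.lt_or_eq with hu | hu
  · have := mul_nonneg hδ0.le (sq_nonneg (α - m / δ))
    nlinarith
  · have hu' : u = 0 := by simpa using hu.symm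
    have hα : α ≠ 0 := by
      rintro rfl
      exact hx (by simp [hxu, hu'])
    have hm : m = 0 := by simp [m, hu']
    rw [hm, hu']
    have := pow_pos (abs_pos.2 hα) 2
    rw [sq_abs] at this
    simp
    positivity

theorem IsQuasiConvex.form_midpoint_lt_fin {p : Poly g} (hp : IsQuasiConvex p) {n : ℕ}
    {X Y : Fin g → Matrix (Fin n) (Fin n) ℝ} (hX : ∀ j, (X j).IsSymm) (hY : ∀ j, (Y j).IsSymm)
    {v : Fin n → ℝ} {c : ℝ} (hc : 0 < c) (h1 : v ⬝ᵥ evalOn X p *ᵥ v < c)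
    (h2 : v ⬝ᵥ evalOn Y p *ᵥ v < c) :
    v ⬝ᵥ evalOn ((1 / 2 : ℝ) • X + (1 / 2 : ℝ) • Y) p *ᵥ v < c := by
  rcases eq_or_ne v 0 with rfl | hv
  · simpa using hc
  obtain ⟨K₁, hK₁⟩ := exists_posDef_barrier_sub (evalOn_isSymm hX hp.symmetric) hv h1
  obtain ⟨K₂, hK₂⟩ := exists_posDef_barrier_sub (evalOn_isSymm hY hp.symmetric) hv h2
  -- Applied to the zero matrix, this makes the barrier itself positive definite; here `c > 0`
  -- enters.
  obtain ⟨K₃, hK₃⟩ := exists_posDef_barrier_sub (M := (0 : Matrix (Fin n) (Fin n) ℝ))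
    (by simp [IsSymm]) hv (c := c) (by simpa using hc)
  set K := max K₁ (max K₂ K₃)
  have hA : (barrier v c K).PosDef := by
    have := hK₃ K (le_trans (le_max_right _ _) (le_max_right _ _))
    rwa [sub_zero] at this
  have hm := hp.convex n _ hA (x := X) ⟨hX, hK₁ K (le_max_left _ _)⟩ (y := Y)
    ⟨hY, hK₂ K (le_trans (le_max_left _ _) (le_max_right _ _))⟩
    (a := 1 / 2) (b := 1 / 2) (by norm_num) (by norm_num) (by norm_num)
  have := hm.2.dotProduct_mulVec_pos hv
  rw [star_trivial, sub_mulVec, dotProduct_sub, dotProduct_barrier_mulVec_self hv] at this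
  rw [eval_eq_evalOn] at this
  linarith

theorem dotProduct_submatrix_mulVec {ι κ : Type*} [Fintype ι] [Fintype κ] (e : ι ≃ κ) (M : Matrix ι ι ℝ)
    (v w : ι → ℝ) :
    (w ∘ e.symm) ⬝ᵥ M.submatrix e.symm e.symm *ᵥ (v ∘ e.symm) = w ⬝ᵥ M *ᵥ v := by
  rw [submatrix_mulVec_equiv]
  simp only [Equiv.symm_symm, Function.comp_assoc, Equiv.symm_comp_self, Function.comp_id]
  rw [comp_equiv_symm_dotProduct]
  simp [Function.comp_assoc]

/-- For a quasi-convex `p` and a vector `v`, the strict sublevel sets of `X ↦ ⟨p(X)v, v⟩` at positive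
heights are midpoint convex. -/
theorem IsQuasiConvex.form_midpoint_lt {p : Poly g} (hp : IsQuasiConvex p)
    {X Y : Fin g → Matrix ι ι ℝ} (hX : ∀ j, (X j).IsSymm) (hY : ∀ j, (Y j).IsSymm)
    {v : ι → ℝ} {c : ℝ} (hc : 0 < c) (h1 : v ⬝ᵥ evalOn X p *ᵥ v < c)
    (h2 : v ⬝ᵥ evalOn Y p *ᵥ v < c) :
    v ⬝ᵥ evalOn ((1 / 2 : ℝ) • X + (1 / 2 : ℝ) • Y) p *ᵥ v < c := by
  set e := Fintype.equivFin ι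
  rw [← dotProduct_submatrix_mulVec e, reindex_evalOn] at h1 h2 ⊢
  exact hp.form_midpoint_lt_fin (fun j => (hX j).submatrix _) (fun j => (hY j).submatrix _) hc h1 h2

end FreePoly
end

/-! ### Second variation along bordered tuples, the degree bound and the quadratic case. -/

noncomputable section
namespace FreePoly
open Matrix
variable {g : ℕ} {ι : Type*} [Fintype ι] [DecidableEq ι]

/-- The tuple `X` bordered by one row and column `t • b`. -/
def bordered (X : Fin g → Matrix ι ι ℝ) (b : Fin g → ι → ℝ) (t : ℝ) :
    Fin g → Matrix (ι ⊕ Unit) (ι ⊕ Unit) ℝ :=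
  fun j => fromBlocks (X j) (t • replicateCol Unit (b j)) (t • replicateRow Unit (b j)) 0

omit [Fintype ι] [DecidableEq ι] in
theorem bordered_isSymm {X : Fin g → Matrix ι ι ℝ} (hX : ∀ j, (X j).IsSymm) (b : Fin g → ι → ℝ)
    (t : ℝ) (j : Fin g) : (bordered X b t j).IsSymm := by
  simp [bordered, IsSymm, fromBlocks_transpose, (hX j).eq]

omit [Fintype ι] [DecidableEq ι] in
theorem bordered_midpoint (X : Fin g → Matrix ι ι ℝ) (b : Fin g → ι → ℝ) (t : ℝ) :
    (1 / 2 : ℝ) • bordered X b t + (1 / 2 : ℝ) • bordered X b (-t) = bordered X b 0 := by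
  funext j
  ext (i | i) (k | k)
  · simp only [bordered, Pi.add_apply, Pi.smul_apply, Matrix.add_apply, Matrix.smul_apply,
      fromBlocks_apply₁₁, smul_eq_mul]
    ring
  all_goals simp [bordered]

omit [DecidableEq ι] in
theorem bordered_mulVec (X : Fin g → Matrix ι ι ℝ) (b : Fin g → ι → ℝ) (t : ℝ) (j : Fin g)
    (u : ι → ℝ) (s : ℝ) :
    bordered X b t j *ᵥ Sum.elim u (fun _ => s) =
      Sum.elim (X j *ᵥ u + (t * s) • b j) (fun _ => t * (b j ⬝ᵥ u)) := by
  rw [bordered, fromBlocks_mulVec]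
  congr 1
  · funext i
    simp [mulVec, dotProduct]
    ring
  · funext i
    simp [mulVec, dotProduct, Finset.mul_sum, mul_assoc]

/-- The first order coefficient of the border component of `l(Z_t)(v ⊕ 0)`, where `Z_t` is the tuple
`X` bordered by `t • b`. -/
def firstOrder (X : Fin g → Matrix ι ι ℝ) (b : Fin g → ι → ℝ) (v : ι → ℝ) : List (Fin g) → ℝ
  | [] => 0
  | j :: l => b j ⬝ᵥ evalOn X (word l) *ᵥ v

/-- The second order coefficient of the main component of `l(Z_t)(v ⊕ 0)`. -/
def secondOrder (X : Fin g → Matrix ι ι ℝ) (b : Fin g → ι → ℝ) (v : ι → ℝ) :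
    List (Fin g) → ι → ℝ
  | [] => 0
  | j :: l => X j *ᵥ secondOrder X b v l + firstOrder X b v l • b j

/-- Each passage between the main block and the border costs a factor `t`, so the main component is
even and the border component odd in `t`. Only orders up to two matter, so a cubic remainder with
continuous coefficient suffices. -/
theorem bordered_word_mulVec (X : Fin g → Matrix ι ι ℝ) (b : Fin g → ι → ℝ) (v : ι → ℝ)
    (l : List (Fin g)) :
    ∃ (R : ℝ → ι → ℝ) (r : ℝ → ℝ), Continuous R ∧ Continuous r ∧ ∀ t : ℝ,
      evalOn (bordered X b t) (word l) *ᵥ Sum.elim v (fun _ => 0) =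
        Sum.elim (evalOn X (word l) *ᵥ v + t ^ 2 • secondOrder X b v l + t ^ 3 • R t)
          (fun _ => t * firstOrder X b v l + t ^ 3 * r t) := by
  induction l with
  | nil => exact ⟨0, 0, continuous_const, continuous_const, fun t => by
      simp [firstOrder, secondOrder]⟩
  | cons j l ih =>
    obtain ⟨R, r, hR, hr, h⟩ := ih
    refine ⟨fun t => X j *ᵥ R t + (t * r t) • b j,
      fun t => b j ⬝ᵥ secondOrder X b v l + t * (b j ⬝ᵥ R t), ?_, ?_, fun t => ?_⟩
    · exact (Continuous.matrix_mulVec continuous_const hR).add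
        ((continuous_id.mul hr).smul continuous_const)
    · exact continuous_const.add
        (continuous_id.mul (Continuous.dotProduct continuous_const hR))
    · rw [word_cons, map_mul, evalOn_ι, ← mulVec_mulVec, h, bordered_mulVec]
      simp only [map_mul, evalOn_ι, firstOrder, secondOrder, mulVec_add, mulVec_smul,
        dotProduct_add, dotProduct_smul, smul_eq_mul, mulVec_mulVec]
      congr 1
      · funext i
        simp only [Pi.add_apply, Pi.smul_apply, smul_eq_mul]
        ring
      · funext i
        ring

theorem bordered_form (X : Fin g → Matrix ι ι ℝ) (b : Fin g → ι → ℝ) (v : ι → ℝ) (p : Poly g) :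
    ∃ r : ℝ → ℝ, Continuous r ∧ ∀ t : ℝ,
      Sum.elim v (fun _ => 0) ⬝ᵥ evalOn (bordered X b t) p *ᵥ Sum.elim v (fun _ => 0) =
        v ⬝ᵥ evalOn X p *ᵥ v + t ^ 2 * ∑ l ∈ supp p, coef l p * (v ⬝ᵥ secondOrder X b v l) +
          t ^ 3 * r t := by
  choose R r hR hr h using bordered_word_mulVec X b v
  refine ⟨fun t => ∑ l ∈ supp p, coef l p * (v ⬝ᵥ R l t), ?_, fun t => ?_⟩
  · exact continuous_finsetSum _ fun l _ => continuous_const.mul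
      (Continuous.dotProduct continuous_const (hR l))
  · rw [evalOn_eq_sum, evalOn_eq_sum X]
    simp only [sum_mulVec, smul_mulVec, h, dotProduct_sum, dotProduct_smul, smul_eq_mul,
      sumElim_dotProduct_sumElim, dotProduct_add, Finset.mul_sum, ← Finset.sum_add_distrib]
    refine Finset.sum_congr rfl fun l _ => ?_
    simp
    ring

/-- A negative second-order term would put the values for `t` and `-t` strictly below `c = ⟨p(X)v,
v⟩`, an admissible height because it is positive; at the midpoint, bordered by zero, the value is
exactly `c`. -/
theorem IsQuasiConvex.secondOrder_nonneg {p : Poly g} (hp : IsQuasiConvex p)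
    {X : Fin g → Matrix ι ι ℝ} (hX : ∀ j, (X j).IsSymm) (b : Fin g → ι → ℝ) {v : ι → ℝ}
    (hv : 0 < v ⬝ᵥ evalOn X p *ᵥ v) :
    0 ≤ ∑ l ∈ supp p, coef l p * (v ⬝ᵥ secondOrder X b v l) := by
  obtain ⟨r, hr, h⟩ := bordered_form X b v p
  by_contra! hq
  set q := ∑ l ∈ supp p, coef l p * (v ⬝ᵥ secondOrder X b v l)
  have hcont : Continuous fun t : ℝ => q + t * r t := by fun_prop
  have hev := hcont.continuousAt.eventually_lt (x₀ := (0 : ℝ)) (g := fun _ => 0)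
    continuousAt_const (by simpa using hq)
  obtain ⟨δ, hδ, hball⟩ := Metric.eventually_nhds_iff.1 hev
  have key : ∀ t : ℝ, t ≠ 0 → |t| < δ → Sum.elim v (fun _ => 0) ⬝ᵥ
      evalOn (bordered X b t) p *ᵥ Sum.elim v (fun _ => 0) < v ⬝ᵥ evalOn X p *ᵥ v := by
    intro t ht htδ
    have h1 := hball (y := t) (by simpa using htδ)
    have h2 : 0 < t ^ 2 := by positivity
    rw [h t]
    nlinarith
  have hm := hp.form_midpoint_lt (bordered_isSymm hX b (δ / 2)) (bordered_isSymm hX b (-(δ / 2)))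
    hv (key (δ / 2) (by positivity) (by rw [abs_of_pos (by positivity)]; linarith))
    (key (-(δ / 2)) (neg_ne_zero.2 (by positivity))
      (by rw [abs_neg, abs_of_pos (by positivity)]; linarith))
  rw [bordered_midpoint, h 0] at hm
  simp at hm

/-- The sum of `y(j, a.reverse) * y(i, c)` over all decompositions `e.reverse ++ l = a ++ j :: i :: c`
with `e.reverse` a prefix of `a`. -/
def splitSum (y : Fin g → List (Fin g) → ℝ) : List (Fin g) → List (Fin g) → ℝ
  | [], _ => 0
  | [_], _ => 0
  | j :: i :: l, e => splitSum y (i :: l) (j :: e) + y j e * y i l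

/-- Symmetry of `X_j` moves the letters one by one onto the left vector, where they accumulate
reversed in `e`. Each summand marks two adjacent letters that cross to the border and back. -/
theorem dotProduct_secondOrder {X : Fin g → Matrix ι ι ℝ} (hX : ∀ j, (X j).IsSymm)
    (b : Fin g → ι → ℝ) (v : ι → ℝ) (l e : List (Fin g)) :
    (evalOn X (word e) *ᵥ v) ⬝ᵥ secondOrder X b v l =
      splitSum (fun j m => b j ⬝ᵥ evalOn X (word m) *ᵥ v) l e := by
  induction l generalizing e with
  | nil => simp [secondOrder, splitSum]
  | cons j l ih =>
    have h1 : (evalOn X (word e) *ᵥ v) ⬝ᵥ secondOrder X b v (j :: l) =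
        (evalOn X (word (j :: e)) *ᵥ v) ⬝ᵥ secondOrder X b v l +
          (b j ⬝ᵥ evalOn X (word e) *ᵥ v) * firstOrder X b v l := by
      rw [secondOrder, dotProduct_add, dotProduct_smul, smul_eq_mul, mul_comm,
        dotProduct_comm _ (b j), word_cons, map_mul, evalOn_ι, ← mulVec_mulVec,
        dotProduct_mulVec, ← mulVec_transpose, (hX j).eq]
    rw [h1, ih]
    cases l with
    | nil => simp [splitSum, firstOrder]
    | cons i l => simp [splitSum, firstOrder]

theorem IsQuasiConvex.splitSum_nonneg {p : Poly g} (hp : IsQuasiConvex p)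
    {X : Fin g → Matrix ι ι ℝ} (hX : ∀ j, (X j).IsSymm) (b : Fin g → ι → ℝ) {v : ι → ℝ}
    (hv : 0 < v ⬝ᵥ evalOn X p *ᵥ v) :
    0 ≤ ∑ l ∈ supp p,
      coef l p * splitSum (fun j m => b j ⬝ᵥ evalOn X (word m) *ᵥ v) l [] := by
  have := hp.secondOrder_nonneg hX b hv
  simp only [← dotProduct_secondOrder hX]
  simpa using this

theorem splitSum_congr {y z : Fin g → List (Fin g) → ℝ} {l e : List (Fin g)}
    (h : ∀ j m, m.length + 2 ≤ l.length + e.length → y j m = z j m) :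
    splitSum y l e = splitSum z l e := by
  induction l generalizing e with
  | nil => rfl
  | cons j l ih =>
    cases l with
    | nil => rfl
    | cons i l =>
      simp only [splitSum]
      simp only [List.length_cons] at h
      rw [ih (fun j' m hm => h j' m (by simp only [List.length_cons] at hm; omega)),
        h j e (by omega), h i l (by omega)]

/-- The values on words which detect the top coefficient `a.reverse ++ [i₀, j₀]`. -/
def probe (i₀ j₀ : Fin g) (a : List (Fin g)) (s : ℝ) (j : Fin g) (m : List (Fin g)) : ℝ :=
  (if j = i₀ ∧ m = a then s else 0) + if j = j₀ ∧ m = [] then 1 else 0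

/-- With `e` nonempty the first factor cannot take its value `1`, and the length bound allows `e =
a` only at the last split, where the tail is empty. -/
theorem splitSum_probe_of_ne_nil {i₀ j₀ : Fin g} {a : List (Fin g)} (ha : a ≠ []) (s : ℝ)
    (l e : List (Fin g)) (he : e ≠ []) (hl : 2 ≤ l.length)
    (hle : e.length + l.length ≤ a.length + 2) :
    splitSum (probe i₀ j₀ a s) l e =
      if e.reverse ++ l = a.reverse ++ [i₀, j₀] then s else 0 := by
  induction l generalizing e with
  | nil => simp at hl
  | cons j l ih =>
    cases l with
    | nil => simp at hl
    | cons i l =>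
      simp only [splitSum]
      cases l with
      | nil =>
        have hiff : e.reverse ++ [j, i] = a.reverse ++ [i₀, j₀] ↔ (j = i₀ ∧ e = a) ∧ i = j₀ := by
          rw [List.append_eq_append_iff_of_size_eq_right (by simp)]
          simp
          tauto
        simp only [splitSum, probe, he, ha.symm, hiff, and_false, if_false, and_true]
        by_cases h1 : j = i₀ ∧ e = a <;> by_cases h2 : i = j₀ <;> simp [h1, h2]
      | cons k l =>
        rw [ih (j :: e) (by simp) (by simp) (by simp at hle ⊢; omega)]
        have hea : e ≠ a := by
          rintro rfl
          simp at hle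
        simp [probe, he, hea]

/-- The products `s·1`, `1·s` and `1·1` give the three words. A product `s·s` would need a word of
length `2|a| + 2`, too long as `a` is nonempty; hence the value is affine in `s`. -/
theorem splitSum_probe_nil {i₀ j₀ : Fin g} {a : List (Fin g)} (ha : a ≠ []) (s : ℝ)
    (l : List (Fin g)) (hle : l.length ≤ a.length + 2) :
    splitSum (probe i₀ j₀ a s) l [] =
      (if l = a.reverse ++ [i₀, j₀] then s else 0) + (if l = j₀ :: i₀ :: a then s else 0) +
        if l = [j₀, j₀] then 1 else 0 := by
  have hrev : ∀ m : List (Fin g), m.length ≤ 2 → m ≠ a.reverse ++ [i₀, j₀] := by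
    rintro m hm rfl
    have := List.length_pos_iff.2 ha
    simp at hm
    exact ha hm
  match l with
  | [] => simp [splitSum]
  | [j] => simp [splitSum, hrev [j] (by simp)]
  | [j, i] =>
    simp only [splitSum, hrev [j, i] (by simp), probe, ha.symm]
    by_cases h1 : j = j₀ <;> by_cases h2 : i = j₀ <;> simp [h1, h2, ha.symm]
  | j :: i :: k :: l =>
    rw [splitSum, splitSum_probe_of_ne_nil ha s _ [j] (by simp) (by simp) (by simp at hle ⊢; omega)]
    simp only [probe, ha.symm]
    by_cases h1 : j = j₀ <;> by_cases h2 : i = i₀ <;> simp [h1, h2]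

theorem sum_supp_mul_ite (p : Poly g) (m : List (Fin g)) (s : ℝ) :
    ∑ l ∈ supp p, coef l p * (if l = m then s else 0) = coef m p * s := by
  simp only [mul_ite, mul_zero, Finset.sum_ite_eq']
  split_ifs with h
  · rfl
  · rw [mem_supp, not_not] at h
    rw [h, zero_mul]

/-- A quasi-convex polynomial which takes a positive value at some `(X, v)`, with `l(X)v` linearly
independent for the words `l` of length at most `degree p`, has degree at most two. -/
theorem IsQuasiConvex.degree_le_two {p : Poly g} (hp : IsQuasiConvex p)
    {X : Fin g → Matrix ι ι ℝ} (hX : ∀ j, (X j).IsSymm) {v : ι → ℝ}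
    (hv : 0 < v ⬝ᵥ evalOn X p *ᵥ v)
    (hind : ∀ y : List (Fin g) → ℝ, ∃ b : ι → ℝ, ∀ m : List (Fin g), m.length ≤ degree p →
      b ⬝ᵥ evalOn X (word m) *ᵥ v = y m) : degree p ≤ 2 := by
  by_contra! hd
  obtain ⟨l₀, hl₀, hlen⟩ := exists_coef_ne_zero_of_degree_pos (p := p) (by omega)
  obtain ⟨j₀, i₀, a, rfl⟩ : ∃ j₀ i₀ a, l₀ = j₀ :: i₀ :: a := by
    match l₀, hlen with
    | [], h => simp at h; omega
    | [_], h => simp at h; omega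
    | j :: i :: a, _ => exact ⟨j, i, a, rfl⟩
  have hlen' : a.length + 2 = degree p := by simpa using hlen
  have ha : a ≠ [] := by
    rintro rfl
    simp at hlen'
    omega
  -- By symmetry of `p` the two top words reinforce each other.
  have hsym : coef (a.reverse ++ [i₀, j₀]) p = coef (j₀ :: i₀ :: a) p := by
    conv_rhs => rw [← hp.symmetric, coef_star]
    simp
  have key : ∀ s : ℝ, 0 ≤ 2 * coef (j₀ :: i₀ :: a) p * s + coef [j₀, j₀] p := by
    intro s
    choose b hb using fun j => hind (probe i₀ j₀ a s j)
    have h := hp.splitSum_nonneg hX b hv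
    have heq : ∀ l ∈ supp p,
        coef l p * splitSum (fun j m => b j ⬝ᵥ evalOn X (word m) *ᵥ v) l [] =
        coef l p * (if l = a.reverse ++ [i₀, j₀] then s else 0) +
          coef l p * (if l = j₀ :: i₀ :: a then s else 0) +
          coef l p * (if l = [j₀, j₀] then 1 else 0) := by
      intro l hl
      have hll := length_le_degree (mem_supp.1 hl)
      rw [← mul_add, ← mul_add, ← splitSum_probe_nil ha s l (by omega)]
      congr 1
      refine splitSum_congr fun j m hm => hb j m ?_
      simp at hm
      omega
    rw [Finset.sum_congr rfl heq, Finset.sum_add_distrib, Finset.sum_add_distrib,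
      sum_supp_mul_ite, sum_supp_mul_ite, sum_supp_mul_ite, hsym] at h
    linarith
  -- This `s` makes the affine expression equal to `-1`.
  have h := key (-(coef [j₀, j₀] p + 1) / (2 * coef (j₀ :: i₀ :: a) p))
  rw [mul_div_cancel₀ _ (by positivity)] at h
  linarith

theorem IsQuasiConvex.coef_nil {p : Poly g} (hp : IsQuasiConvex p) : coef [] p = 0 := by
  have h := congrFun (congrFun (hp.eval_zero 1) 0) 0
  rw [eval_eq_evalOn, evalOn_eq_sum] at h
  have hw : ∀ l : List (Fin g), evalOn (0 : Fin g → Matrix (Fin 1) (Fin 1) ℝ) (word l) =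
      if l = [] then 1 else 0 := by
    intro l
    cases l <;> simp
  simp only [hw, Matrix.sum_apply, Matrix.smul_apply, smul_eq_mul, Matrix.zero_apply] at h
  have h2 := sum_supp_mul_ite p [] 1
  rw [mul_one] at h2
  refine h2.symm.trans (Eq.trans ?_ h)
  refine Finset.sum_congr rfl fun l _ => ?_
  by_cases hl : l = [] <;> simp [hl]

theorem sum_supp_of_degree_le_two {M : Type*} [AddCommGroup M] [Module ℝ M] {p : Poly g}
    (hd : degree p ≤ 2) (f : List (Fin g) → M) :
    ∑ l ∈ supp p, coef l p • f l =
      coef [] p • f [] + ∑ j, coef [j] p • f [j] + ∑ i, ∑ j, coef [i, j] p • f [i, j] := by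
  classical
  set A : Finset (List (Fin g)) := {[]}
  set B : Finset (List (Fin g)) := Finset.univ.image fun j => [j]
  set C : Finset (List (Fin g)) := Finset.univ.image fun q : Fin g × Fin g => [q.1, q.2]
  have hAB : Disjoint A B := by
    simp [A, B]
  have hABC : Disjoint (A ∪ B) C := by
    simp only [A, B, C, Finset.disjoint_left, Finset.mem_union, Finset.mem_image]
    rintro l (h | ⟨j, -, rfl⟩) ⟨q, -, hq⟩
    · simp_all
    · simp_all
  have hsub : supp p ⊆ A ∪ B ∪ C := by
    intro l hl
    have hl' := (length_le_degree (mem_supp.1 hl)).trans hd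
    match l, hl' with
    | [], _ => simp [A]
    | [j], _ => simp [B]
    | [i, j], _ => simp [C]
    | _ :: _ :: _ :: _, h => simp at h
  rw [Finset.sum_subset hsub, Finset.sum_union hABC, Finset.sum_union hAB,
    Finset.sum_singleton, Finset.sum_image (by simp [Set.InjOn]),
    Finset.sum_image (by simp [Set.InjOn, Prod.ext_iff]), Fintype.sum_prod_type]
  intro l _ hl
  rw [mem_supp, not_not] at hl
  rw [hl, zero_smul]

/-- A quasi-convex polynomial of degree at most two which takes a positive value is the sum of a
linear polynomial and of squares of linear polynomials. -/
theorem IsQuasiConvex.eq_linear_add_squares {p : Poly g} (hp : IsQuasiConvex p)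
    {X : Fin g → Matrix ι ι ℝ} (hX : ∀ j, (X j).IsSymm) {v : ι → ℝ}
    (hv : 0 < v ⬝ᵥ evalOn X p *ᵥ v) (hd : degree p ≤ 2) :
    ∃ (l : Poly g) (m : ℕ) (s : Fin m → Poly g),
      IsLinear l ∧ (∀ j, IsLinear (s j)) ∧ p = l + ∑ j, star (s j) * s j := by
  have hv0 : v ⬝ᵥ v ≠ 0 := by
    intro h
    have : v = 0 := by simpa using h
    simp [this] at hv
  set Q : Matrix (Fin g) (Fin g) ℝ := of fun i j => coef [i, j] p with hQ
  have hQs : Q.IsSymm := by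
    ext i j
    simp only [hQ, transpose_apply, of_apply]
    conv_lhs => rw [← hp.symmetric, coef_star]
    simp
  have hQp : Q.PosSemidef := by
    refine PosSemidef.of_dotProduct_mulVec_nonneg ?_ fun x => ?_
    · rw [IsHermitian, conjTranspose_eq_transpose_of_trivial, hQs.eq]
    -- This border gives `⟨b_j, v⟩ = x_j`; in degree two the second variation involves only the
    -- empty word.
    · have h := hp.splitSum_nonneg hX (fun j => (x j / (v ⬝ᵥ v)) • v) hv
      simp only [← smul_eq_mul (a := coef _ p)] at h
      rw [sum_supp_of_degree_le_two hd] at h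
      simp only [splitSum, word_nil, map_one, one_mulVec, smul_dotProduct, smul_eq_mul, zero_add,
        div_mul_cancel₀ _ hv0, mul_zero, Finset.sum_const_zero] at h
      rw [star_trivial]
      refine h.trans_eq ?_
      simp only [dotProduct, mulVec, Finset.mul_sum, hQ, of_apply]
      exact Finset.sum_congr rfl fun i _ => Finset.sum_congr rfl fun j _ => by ring
  obtain ⟨S, hS⟩ := exists_eq_transpose_mul_self hQp
  have hmem : ∀ c : Fin g → ℝ, IsLinear (∑ j, c j • (FreeAlgebra.ι ℝ j : Poly g)) := fun c =>
    Submodule.sum_mem _ fun j _ => Submodule.smul_mem _ _ (Submodule.subset_span ⟨j, rfl⟩)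
  refine ⟨_, g, fun k => ∑ j, S k j • FreeAlgebra.ι ℝ j, hmem fun j => coef [j] p,
    fun k => hmem _, ?_⟩
  conv_lhs => rw [← sum_coef_word p, sum_supp_of_degree_le_two hd, hp.coef_nil]
  simp only [zero_smul, zero_add, word_cons, word_nil, mul_one]
  congr 1
  simp only [star_sum, star_smul_poly, FreeAlgebra.star_ι, Finset.sum_mul_sum, smul_mul_smul_comm]
  refine Eq.trans ?_ Finset.sum_comm
  refine Finset.sum_congr rfl fun i _ => ?_
  refine Eq.trans ?_ Finset.sum_comm
  refine Finset.sum_congr rfl fun j _ => ?_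
  rw [← Finset.sum_smul]
  congr 1
  have := congrFun (congrFun hS i) j
  simpa [hQ, mul_apply] using this

end FreePoly
end

/-! ### Direct sums and the truncated Fock space. -/

noncomputable section
namespace FreePoly
open Matrix
variable {g : ℕ} {ι κ : Type*} [Fintype ι] [DecidableEq ι] [Fintype κ] [DecidableEq κ]

/-- The block diagonal sum of two tuples. -/
def directSum (X : Fin g → Matrix ι ι ℝ) (Y : Fin g → Matrix κ κ ℝ) :
    Fin g → Matrix (ι ⊕ κ) (ι ⊕ κ) ℝ :=
  fun j => fromBlocks (X j) 0 0 (Y j)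

omit [Fintype ι] [DecidableEq ι] [Fintype κ] [DecidableEq κ] in
theorem directSum_isSymm {X : Fin g → Matrix ι ι ℝ} {Y : Fin g → Matrix κ κ ℝ}
    (hX : ∀ j, (X j).IsSymm) (hY : ∀ j, (Y j).IsSymm) (j : Fin g) :
    (directSum X Y j).IsSymm := by
  simp [directSum, IsSymm, fromBlocks_transpose, (hX j).eq, (hY j).eq]

theorem evalOn_directSum (X : Fin g → Matrix ι ι ℝ) (Y : Fin g → Matrix κ κ ℝ) (p : Poly g) :
    evalOn (directSum X Y) p = fromBlocks (evalOn X p) 0 0 (evalOn Y p) := by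
  induction p using FreeAlgebra.induction with
  | grade0 r =>
    rw [AlgHom.commutes, AlgHom.commutes, AlgHom.commutes]
    simp only [Algebra.algebraMap_eq_smul_one, ← fromBlocks_one, fromBlocks_smul, smul_zero]
  | grade1 j => simp [directSum]
  | mul a b ha hb => simp [ha, hb, fromBlocks_multiply]
  | add a b ha hb => simp [ha, hb, fromBlocks_add]

/-- The words of length at most `L`. -/
abbrev Words (g L : ℕ) : Type := {l : List (Fin g) // l.length ≤ L}

instance (g L : ℕ) : Fintype (Words g L) :=
  (List.finite_length_le (Fin g) L).fintype

/-- The empty word. -/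
def Words.nil (g L : ℕ) : Words g L := ⟨[], Nat.zero_le _⟩

/-- The compressions to words of length at most `L` of the sums of the creation and annihilation
operators on the full Fock space. -/
def fock (g L : ℕ) : Fin g → Matrix (Words g L) (Words g L) ℝ :=
  fun j => of fun a b => if a.1 = j :: b.1 ∨ b.1 = j :: a.1 then 1 else 0

/-- The vacuum vector of the truncated Fock space. -/
def vacuum (g L : ℕ) : Words g L → ℝ := Pi.single (Words.nil g L) 1

theorem fock_isSymm (g L : ℕ) (j : Fin g) : (fock g L j).IsSymm := by
  ext a b
  simp [fock, or_comm]

/-- At entries at least as long as `c` annihilation is invisible: it would have to start from a word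
longer than the letters applied so far can create. -/
theorem fock_word_apply {L : ℕ} (c : List (Fin g)) (w : Words g L) (h : c.length ≤ w.1.length) :
    (evalOn (fock g L) (word c) *ᵥ vacuum g L) w = if c = w.1 then 1 else 0 := by
  induction c generalizing w with
  | nil =>
    simp only [word_nil, map_one, one_mulVec, vacuum, Pi.single_apply, Words.nil, Subtype.ext_iff,
      eq_comm]
  | cons j c ih =>
    simp only [List.length_cons] at h
    rw [word_cons, map_mul, evalOn_ι, ← mulVec_mulVec]
    simp only [mulVec, dotProduct]
    have hc : c.length ≤ L := by have := w.2; omega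
    rw [Finset.sum_eq_single (⟨c, hc⟩ : Words g L)]
    · have h1 := ih ⟨c, hc⟩ le_rfl
      simp only [mulVec, dotProduct, if_true] at h1
      rw [h1]
      have h2 : c ≠ j :: w.1 := by
        rintro rfl
        simp at h
      simp [fock, h2, eq_comm]
    · intro b _ hb
      by_cases hwb : w.1 = j :: b.1 ∨ b.1 = j :: w.1
      · have hl : c.length ≤ b.1.length := by
          rcases hwb with h' | h' <;> have := congrArg List.length h' <;>
            simp only [List.length_cons] at this <;> omega
        have h1 := ih b hl
        rw [if_neg fun h' => hb (Subtype.ext h'.symm)] at h1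
        simp only [mulVec, dotProduct] at h1
        rw [h1, mul_zero]
      · simp [fock, hwb]
    · simp

/-- Triangularity in the length: at a longest word with nonzero coefficient, only that word
contributes to the corresponding coordinate. -/
theorem linearIndependent_fock (g L : ℕ) :
    LinearIndependent ℝ fun c : Words g L => evalOn (fock g L) (word c.1) *ᵥ vacuum g L := by
  rw [Fintype.linearIndependent_iff]
  intro f hf
  by_contra! hne
  obtain ⟨i, hi⟩ := hne
  obtain ⟨m, hm, hmax⟩ := Finset.exists_max_image (Finset.univ.filter fun c => f c ≠ 0)
    (fun c : Words g L => c.1.length) ⟨i, by simpa using hi⟩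
  have h := congrFun hf m
  rw [Finset.sum_apply, Finset.sum_eq_single m] at h
  · rw [Pi.smul_apply, fock_word_apply _ _ le_rfl] at h
    simp at h hm
    exact hm h
  · intro c _ hc
    by_cases hfc : f c = 0
    · simp [hfc]
    · rw [Pi.smul_apply, fock_word_apply _ _ (hmax c (by simpa using hfc)),
        if_neg fun h' => hc (Subtype.ext h'), smul_zero]
  · simp

omit [DecidableEq ι] [Fintype κ] [DecidableEq κ] in
theorem exists_dotProduct_eq_of_linearIndependent {f : κ → ι → ℝ} (hf : LinearIndependent ℝ f)
    (y : κ → ℝ) : ∃ b : ι → ℝ, ∀ k, b ⬝ᵥ f k = y k := by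
  classical
  obtain ⟨φ, hφ⟩ := LinearMap.exists_extend
    ((Finsupp.linearCombination ℝ y).comp hf.repr)
  refine ⟨fun i => φ fun j => if i = j then 1 else 0, fun k => ?_⟩
  have h1 : φ (f k) = y k := by
    have h2 := LinearMap.congr_fun hφ ⟨f k, Submodule.subset_span ⟨k, rfl⟩⟩
    simp only [LinearMap.comp_apply, Submodule.subtype_apply] at h2
    rw [h2, hf.repr_eq_single k _ rfl]
    simp
  rw [← h1, φ.pi_apply_eq_sum_univ (f k)]
  simp only [dotProduct, smul_eq_mul, mul_comm]

theorem exists_dotProduct_fock_eq (L : ℕ) (y : List (Fin g) → ℝ) :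
    ∃ b : Words g L → ℝ, ∀ m : List (Fin g), m.length ≤ L →
      b ⬝ᵥ evalOn (fock g L) (word m) *ᵥ vacuum g L = y m := by
  obtain ⟨b, hb⟩ := exists_dotProduct_eq_of_linearIndependent (linearIndependent_fock g L)
    fun c => y c.1
  exact ⟨b, fun m hm => hb ⟨m, hm⟩⟩

/-- Independence yields a vector whose pairing with each `m(X)v` is the coefficient of `m`; its
pairing with `q(X)v` is the sum of the squared coefficients. -/
theorem fock_mulVec_vacuum_ne_zero {L : ℕ} {q : Poly g} (hq : q ≠ 0) (hd : degree q ≤ L) :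
    evalOn (fock g L) q *ᵥ vacuum g L ≠ 0 := by
  intro h0
  obtain ⟨b, hb⟩ := exists_dotProduct_fock_eq (g := g) L fun m => coef m q
  have h1 : b ⬝ᵥ evalOn (fock g L) q *ᵥ vacuum g L = ∑ l ∈ supp q, coef l q * coef l q := by
    rw [evalOn_eq_sum, sum_mulVec, dotProduct_sum]
    refine Finset.sum_congr rfl fun l hl => ?_
    rw [smul_mulVec, dotProduct_smul, hb _ ((length_le_degree (mem_supp.1 hl)).trans hd),
      smul_eq_mul]
  rw [h0, dotProduct_zero, eq_comm, Finset.sum_eq_zero_iff_of_nonneg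
    fun _ _ => mul_self_nonneg _] at h1
  refine hq (poly_ext fun l => ?_)
  rw [map_zero]
  by_contra hl
  exact hl (mul_self_eq_zero.1 (h1 l (mem_supp.2 hl)))

/-- A quasi-convex polynomial which takes a positive value has degree at most two and is the sum of
a linear polynomial and of squares of linear polynomials. -/
theorem IsQuasiConvex.degree_le_two_and_eq {p : Poly g} (hp : IsQuasiConvex p)
    {X : Fin g → Matrix ι ι ℝ} (hX : ∀ j, (X j).IsSymm) {v : ι → ℝ}
    (hv : 0 < v ⬝ᵥ evalOn X p *ᵥ v) :
    degree p ≤ 2 ∧ ∃ (l : Poly g) (m : ℕ) (s : Fin m → Poly g),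
      IsLinear l ∧ (∀ j, IsLinear (s j)) ∧ p = l + ∑ j, star (s j) * s j := by
  have hd : degree p ≤ 2 := by
    set L := degree p
    set F := vacuum g L ⬝ᵥ evalOn (fock g L) p *ᵥ vacuum g L with hF
    -- A small multiple of the vacuum keeps the value positive and, being nonzero, still gives
    -- independence.
    obtain ⟨ε, hε, hpos⟩ : ∃ ε : ℝ, 0 < ε ∧ 0 < v ⬝ᵥ evalOn X p *ᵥ v + ε * (ε * F) := by
      set a := v ⬝ᵥ evalOn X p *ᵥ v
      have hc : Continuous fun ε : ℝ => a + ε * (ε * F) := by fun_prop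
      have hev := continuousAt_const.eventually_lt (f := fun _ => (0 : ℝ)) hc.continuousAt
        (x₀ := (0 : ℝ)) (by simpa using hv)
      obtain ⟨δ, hδ, hball⟩ := Metric.eventually_nhds_iff.1 hev
      exact ⟨δ / 2, by positivity, hball (by
        rw [dist_zero_right, Real.norm_eq_abs, abs_of_pos (by positivity)]; linarith)⟩
    refine hp.degree_le_two (X := directSum X (fock g L)) (v := Sum.elim v (ε • vacuum g L))
      (directSum_isSymm hX (fock_isSymm g L)) ?_ fun y => ?_
    · rw [evalOn_directSum, fromBlocks_mulVec]
      simpa [sumElim_dotProduct_sumElim, mulVec_smul, hF] using hpos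
    · obtain ⟨b, hb⟩ := exists_dotProduct_fock_eq (g := g) L y
      refine ⟨Sum.elim 0 (ε⁻¹ • b), fun m hm => ?_⟩
      rw [evalOn_directSum, fromBlocks_mulVec]
      simp [sumElim_dotProduct_sumElim, mulVec_smul, hb m hm, hε.ne']
  exact ⟨hd, hp.eq_linear_add_squares hX hv hd⟩

end FreePoly
end

/-! ### Nonnegative free polynomials are sums of squares. -/

noncomputable section
namespace FreePoly
open Matrix
variable {g : ℕ}

/-- The polynomial with the given coefficients on the words of length at most `L`. -/
def polyOf {L : ℕ} (x : Words g L → ℝ) : Poly g := ∑ a, x a • word a.1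

theorem coef_polyOf {L : ℕ} (x : Words g L → ℝ) (a : Words g L) : coef a.1 (polyOf x) = x a := by
  simp [polyOf, coef_word, Subtype.val_inj]

theorem coef_polyOf_of_lt {L : ℕ} (x : Words g L → ℝ) {l : List (Fin g)} (h : L < l.length) :
    coef l (polyOf x) = 0 := by
  rw [polyOf, map_sum]
  refine Finset.sum_eq_zero fun a _ => ?_
  rw [map_smul, coef_word, if_neg, smul_zero]
  rintro rfl
  exact absurd a.2 (by omega)

theorem degree_le_of_coef {q : Poly g} {L : ℕ} (h : ∀ l, L < l.length → coef l q = 0) :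
    degree q ≤ L := by
  refine Finset.sup_le fun l hl => ?_
  by_contra! hlt
  exact mem_supp.1 hl (h l hlt)

theorem degree_polyOf_le {L : ℕ} (x : Words g L → ℝ) : degree (polyOf x) ≤ L :=
  degree_le_of_coef fun _ h => coef_polyOf_of_lt x h

/-- The polynomial with Gram matrix `G`. -/
def gram {L : ℕ} : Matrix (Words g L) (Words g L) ℝ →ₗ[ℝ] Poly g where
  toFun G := ∑ a, ∑ b, G a b • (star (word a.1) * word b.1)
  map_add' G H := by simp [add_smul, Finset.sum_add_distrib]
  map_smul' c G := by simp [mul_smul, Finset.smul_sum]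

theorem gram_apply {L : ℕ} (G : Matrix (Words g L) (Words g L) ℝ) :
    gram G = ∑ a, ∑ b, G a b • (star (word a.1) * word b.1) := rfl

theorem gram_vecMulVec {L : ℕ} (x : Words g L → ℝ) :
    gram (vecMulVec x x) = star (polyOf x) * polyOf x := by
  simp only [gram_apply, polyOf, star_sum, star_smul_poly, Finset.sum_mul_sum, smul_mul_smul_comm,
    vecMulVec_apply]

theorem gram_transpose_mul_self {L : ℕ} (S : Matrix (Words g L) (Words g L) ℝ) :
    gram (Sᵀ * S) = ∑ k, star (polyOf (S k)) * polyOf (S k) := by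
  have : Sᵀ * S = ∑ k, vecMulVec (S k) (S k) := by
    ext a b
    simp [mul_apply, Matrix.sum_apply, vecMulVec_apply]
  simp only [this, map_sum, gram_vecMulVec]

theorem coef_gram_of_lt {L : ℕ} (G : Matrix (Words g L) (Words g L) ℝ) {l : List (Fin g)}
    (h : 2 * L < l.length) : coef l (gram G) = 0 := by
  simp only [gram_apply, map_sum, star_word, ← word_append, map_smul, coef_word]
  refine Finset.sum_eq_zero fun a _ => Finset.sum_eq_zero fun b _ => ?_
  rw [if_neg, smul_zero]
  rintro rfl
  have := a.2
  have := b.2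
  simp only [List.length_append, List.length_reverse] at h
  omega

theorem isHermitianSOS_sum {κ : Type*} [Fintype κ] (h : κ → Poly g) :
    IsHermitianSOS (∑ k, star (h k) * h k) :=
  ⟨Fintype.card κ, fun i => h ((Fintype.equivFin κ).symm i),
    ((Fintype.equivFin κ).symm.sum_comp fun k => star (h k) * h k).symm⟩

theorem isHermitianSOS_smul_gram {L : ℕ} {G : Matrix (Words g L) (Words g L) ℝ}
    (hG : G.PosSemidef) {s : ℝ} (hs : 0 ≤ s) : IsHermitianSOS (s • gram G) := by
  obtain ⟨S, hS⟩ := exists_eq_transpose_mul_self (hG.smul hs)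
  rw [← map_smul, hS, gram_transpose_mul_self]
  exact isHermitianSOS_sum _

/-- In a vanishing sum of squares every factor kills the Fock vacuum, hence is zero. So the image of
the trace-one matrices avoids `0`, as the separation requires. -/
theorem eq_zero_of_gram_eq_zero {L : ℕ} {G : Matrix (Words g L) (Words g L) ℝ}
    (hG : G.PosSemidef) (h : gram G = 0) : G = 0 := by
  obtain ⟨S, rfl⟩ := exists_eq_transpose_mul_self hG
  rw [gram_transpose_mul_self] at h
  have h1 := congrArg (fun q => vacuum g L ⬝ᵥ evalOn (fock g L) q *ᵥ vacuum g L) h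
  simp only [map_sum, map_mul, evalOn_star (fock_isSymm g L), sum_mulVec, dotProduct_sum, map_zero,
    zero_mulVec, dotProduct_zero, ← mulVec_mulVec] at h1
  have h2 : ∀ k, vacuum g L ⬝ᵥ (evalOn (fock g L) (polyOf (S k)))ᵀ *ᵥ
      evalOn (fock g L) (polyOf (S k)) *ᵥ vacuum g L =
      (evalOn (fock g L) (polyOf (S k)) *ᵥ vacuum g L) ⬝ᵥ
        (evalOn (fock g L) (polyOf (S k)) *ᵥ vacuum g L) := by
    intro k
    rw [dotProduct_mulVec, vecMul_transpose]
  simp only [h2] at h1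
  rw [Finset.sum_eq_zero_iff_of_nonneg fun _ _ => zero_le_dotProduct_self _] at h1
  have h3 : S = 0 := by
    ext k a
    have h4 : polyOf (S k) = 0 := by
      by_contra hne
      exact fock_mulVec_vacuum_ne_zero hne (degree_polyOf_le _)
        (dotProduct_self_eq_zero.1 (h1 k (Finset.mem_univ k)))
    rw [← coef_polyOf (S k) a, h4, map_zero, Matrix.zero_apply]
  simp [h3]

section Spectrahedron

variable (ι : Type*) [Fintype ι] [DecidableEq ι]

/-- The positive semidefinite matrices of trace one. -/
def density : Set (Matrix ι ι ℝ) := {G | G.PosSemidef ∧ G.trace = 1}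

omit [DecidableEq ι] in
theorem convex_density : Convex ℝ (density ι) := by
  intro G hG H hH a b ha hb hab
  refine ⟨(hG.1.smul ha).add (hH.1.smul hb), ?_⟩
  rw [trace_add, trace_smul, trace_smul, hG.2, hH.2]
  simpa using hab

variable {ι}

theorem abs_apply_le_trace {G : Matrix ι ι ℝ} (hG : G.PosSemidef) (i j : ι) :
    |G i j| ≤ G.trace := by
  have hd : ∀ k, G k k ≤ G.trace := fun k =>
    Finset.single_le_sum (f := fun k => G k k) (fun k _ => hG.diag_nonneg) (Finset.mem_univ k)
  have hs : G j i = G i j := by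
    have := hG.1.apply i j
    simpa using this
  have h1 := hG.dotProduct_mulVec_nonneg (Pi.single i 1 + Pi.single j 1)
  have h2 := hG.dotProduct_mulVec_nonneg (Pi.single i 1 - Pi.single j 1)
  simp only [star_trivial, mulVec_add, mulVec_sub, add_dotProduct, sub_dotProduct, dotProduct_add,
    dotProduct_sub, mulVec_single_one, single_one_dotProduct, col_apply, hs] at h1 h2
  have := hd i
  have := hd j
  rw [abs_le]
  constructor <;> linarith

theorem isCompact_density : IsCompact (density ι) := by
  have hbox : IsCompact (Set.univ.pi fun _ : ι => Set.univ.pi fun _ : ι => Set.Icc (-1 : ℝ) 1) :=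
    isCompact_univ_pi fun _ => isCompact_univ_pi fun _ => isCompact_Icc
  refine hbox.of_isClosed_subset ?_ ?_
  · have hset : density ι = {G | Gᵀ = G} ∩ (⋂ x : ι → ℝ, {G | 0 ≤ x ⬝ᵥ G *ᵥ x}) ∩
        {G | G.trace = 1} := by
      ext G
      simp only [density, posSemidef_iff_dotProduct_mulVec, IsHermitian,
        conjTranspose_eq_transpose_of_trivial, star_trivial, Set.mem_ofPred_eq, Set.mem_inter_iff,
        Set.mem_iInter]
    rw [hset]
    refine ((isClosed_eq (Continuous.matrix_transpose continuous_id) continuous_id).inter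
      (isClosed_iInter fun x => isClosed_le continuous_const ?_)).inter
      (isClosed_eq (Continuous.matrix_trace continuous_id) continuous_const)
    exact Continuous.dotProduct continuous_const
      (Continuous.matrix_mulVec continuous_id continuous_const)
  · intro G hG i _ j _
    rw [Set.mem_Icc, ← abs_le, ← hG.2]
    exact abs_apply_le_trace hG.1 i j

end Spectrahedron

/-- The coefficients on the words of length at most `L`. -/
def coefVec (g L : ℕ) : Poly g →ₗ[ℝ] (Words g L → ℝ) := LinearMap.pi fun a => coef a.1

theorem coefVec_inj {L : ℕ} {q r : Poly g} (hq : ∀ l, L < l.length → coef l q = 0)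
    (hr : ∀ l, L < l.length → coef l r = 0) (h : coefVec g L q = coefVec g L r) : q = r := by
  refine poly_ext fun l => ?_
  by_cases hl : l.length ≤ L
  · exact congrFun h ⟨l, hl⟩
  · rw [hq l (by omega), hr l (by omega)]

/-- A symmetric polynomial which is not a sum of squares is separated from the sums of squares of
bounded degree by a strictly positive functional. -/
theorem exists_separating_functional {f : Poly g} (hf : star f = f) (hsos : ¬ IsHermitianSOS f)
    {L : ℕ} (hL : degree f ≤ 2 * L) :
    ∃ Λ : Poly g →ₗ[ℝ] ℝ, (∀ q, Λ (star q) = Λ q) ∧ Λ f < 0 ∧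
      ∀ x : Words g L → ℝ, x ≠ 0 → 0 < Λ (star (polyOf x) * polyOf x) := by
  have hfL : ∀ l, 2 * L < l.length → coef l f = 0 := fun l hl =>
    coef_eq_zero_of_degree_lt (by omega)
  set T : Matrix (Words g L) (Words g L) ℝ →ₗ[ℝ] (Words g (2 * L) → ℝ) :=
    (coefVec g (2 * L)).comp gram with hT
  have hTc : Continuous T := T.continuous_of_finiteDimensional
  -- Separating the compact image of the trace-one matrices from the closed ray through `f` avoids
  -- having to show that the cone of sums of squares is closed.
  set ray : Set (Words g (2 * L) → ℝ) := (fun s : ℝ => s • coefVec g (2 * L) f) '' Set.Ici 0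
  have hf0 : coefVec g (2 * L) f ≠ 0 := by
    intro h
    refine hsos ⟨0, Fin.elim0, ?_⟩
    rw [coefVec_inj hfL (r := 0) (by simp) (by rw [h, map_zero])]
    simp
  have hray : IsClosed ray :=
    (isClosedMap_smul_left (coefVec g (2 * L) f)) _ isClosed_Ici
  have hrayc : Convex ℝ ray :=
    (convex_Ici 0).is_linear_image ⟨fun a b => add_smul a b _, fun c a => mul_smul c a _⟩
  have hdisj : Disjoint (T '' density _) ray := by
    rw [Set.disjoint_left]
    rintro _ ⟨G, hG, rfl⟩ ⟨s, hs, hsG⟩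
    rw [Set.mem_Ici] at hs
    have heq : s • f = gram G := by
      refine coefVec_inj (L := 2 * L) (fun l hl => ?_) (fun l hl => coef_gram_of_lt G hl) ?_
      · rw [map_smul, hfL l hl, smul_zero]
      · rw [map_smul]
        exact hsG
    rcases hs.eq_or_lt with rfl | hs
    · rw [zero_smul] at heq
      have := hG.2
      rw [eq_zero_of_gram_eq_zero hG.1 heq.symm] at this
      simp at this
    · apply hsos
      rw [← inv_smul_smul₀ hs.ne' f, heq]
      exact isHermitianSOS_smul_gram hG.1 (inv_nonneg.2 hs.le)
  obtain ⟨φ, u, w, hφu, huw, hφw⟩ := geometric_hahn_banach_compact_closed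
    ((convex_density _).linear_image T) ((isCompact_density).image hTc) hrayc hray hdisj
  have hw0 : w < 0 := by simpa using hφw 0 ⟨0, by simp, by simp⟩
  have hφf : 0 ≤ φ (coefVec g (2 * L) f) := by
    by_contra! hneg
    have h := hφw _ ⟨w / φ (coefVec g (2 * L) f), div_nonneg_of_nonpos hw0.le hneg.le, rfl⟩
    rw [map_smul, smul_eq_mul, div_mul_cancel₀ _ hneg.ne] at h
    exact lt_irrefl _ h
  obtain ⟨a, ha⟩ := Function.ne_iff.1 hf0
  obtain ⟨R, hR⟩ := (((isCompact_density (ι := Words g L)).image hTc).image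
    (continuous_apply a)).isBounded.exists_norm_le
  have hu0 : 0 < -u := by linarith
  set c := coefVec g (2 * L) f a
  have hc : 0 < |c| := abs_pos.2 ha
  -- Separation gives only `φ(f) ≥ 0`. Perturbing by a coordinate where `f` is nonzero makes the
  -- value at `f` strictly negative, and this `ε` stays within the gap `-u` available on the compact
  -- set.
  set ε := -u / (|c| * |R| + 1)
  have hε : 0 < ε := by positivity
  set Λ₀ : Poly g →ₗ[ℝ] ℝ := -(φ.toLinearMap.comp (coefVec g (2 * L))) - (ε * c) • coef a.1
  have hΛ₀ : ∀ q, Λ₀ q = -φ (coefVec g (2 * L) q) - ε * c * coef a.1 q := fun q => rfl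
  have hΛ₀f : Λ₀ f < 0 := by
    have h1 : Λ₀ f = -φ (coefVec g (2 * L) f) - ε * c * c := hΛ₀ f
    have h2 : 0 < ε * (c * c) := mul_pos hε (mul_self_pos.2 ha)
    rw [h1]
    linarith
  have hΛ₀G : ∀ G ∈ density (Words g L), 0 < Λ₀ (gram G) := by
    intro G hG
    have h1 := hφu _ ⟨G, hG, rfl⟩
    have h2 : |coef a.1 (gram G)| ≤ |R| := (hR _ ⟨_, ⟨G, hG, rfl⟩, rfl⟩).trans (le_abs_self R)
    have h3 : ε * c * coef a.1 (gram G) ≤ ε * (|c| * |R|) := by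
      rw [mul_assoc]
      refine mul_le_mul_of_nonneg_left ((le_abs_self _).trans ?_) hε.le
      rw [abs_mul]
      exact mul_le_mul_of_nonneg_left h2 hc.le
    have h4 : ε * (|c| * |R| + 1) = -u := div_mul_cancel₀ _ (by positivity)
    have h5 : φ (coefVec g (2 * L) (gram G)) < u := h1
    rw [hΛ₀]
    linarith
  -- Adding the composition with the involution symmetrises the functional; the signs survive
  -- because `f` and the squares are symmetric.
  let starLin : Poly g →ₗ[ℝ] Poly g :=
    { toFun := star, map_add' := star_add, map_smul' := star_smul_poly }
  have hΛ : ∀ q, (Λ₀ + Λ₀.comp starLin) q = Λ₀ q + Λ₀ (star q) := fun q => rfl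
  refine ⟨Λ₀ + Λ₀.comp starLin, fun q => ?_, ?_, fun x hx => ?_⟩
  · rw [hΛ, hΛ, star_star, add_comm]
  · rw [hΛ, hf]
    linarith
  · have hxx : 0 < x ⬝ᵥ x :=
      lt_of_le_of_ne (zero_le_dotProduct_self x) (Ne.symm (by simpa using hx))
    have hmem : (x ⬝ᵥ x)⁻¹ • vecMulVec x x ∈ density (Words g L) := by
      refine ⟨PosSemidef.smul ?_ (inv_nonneg.2 hxx.le), ?_⟩
      · simpa using posSemidef_vecMulVec_self_star x
      · rw [trace_smul, trace_vecMulVec, smul_eq_mul, inv_mul_cancel₀ hxx.ne']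
    have h1 := hΛ₀G _ hmem
    rw [map_smul, gram_vecMulVec, map_smul, smul_eq_mul] at h1
    have h2 : 0 < Λ₀ (star (polyOf x) * polyOf x) := pos_of_mul_pos_right h1
      (inv_nonneg.2 hxx.le)
    rw [hΛ, star_mul, star_star]
    linarith

/-- The Gelfand-Naimark-Segal construction, truncated to words of length at most `L`. -/
theorem exists_tuple_of_functional {L : ℕ} (Λ : Poly g →ₗ[ℝ] ℝ) (hΛ : ∀ q, Λ (star q) = Λ q)
    (hpos : ∀ x : Words g L → ℝ, x ≠ 0 → 0 < Λ (star (polyOf x) * polyOf x)) :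
    ∃ (X : Fin g → Matrix (Words g L) (Words g L) ℝ) (v : Words g L → ℝ), (∀ j, (X j).IsSymm) ∧
      ∀ q : Poly g, degree q ≤ L → v ⬝ᵥ evalOn X q *ᵥ v = Λ q := by
  set M : Matrix (Words g L) (Words g L) ℝ := of fun a b => Λ (star (word a.1) * word b.1) with hM
  set N : Fin g → Matrix (Words g L) (Words g L) ℝ := fun j => of fun a b =>
    Λ (star (word a.1) * (FreeAlgebra.ι ℝ j * word b.1)) with hN
  have hMs : M.IsSymm := by
    ext a b
    simp only [hM, transpose_apply, of_apply]
    rw [← hΛ, star_mul, star_star]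
  have hNs : ∀ j, (N j).IsSymm := by
    intro j
    ext a b
    simp only [hN, transpose_apply, of_apply]
    rw [← hΛ, star_mul, star_star, star_mul, FreeAlgebra.star_ι, mul_assoc]
  have hMp : M.PosDef := by
    refine PosDef.of_dotProduct_mulVec_pos ?_ fun x hx => ?_
    · rw [IsHermitian, conjTranspose_eq_transpose_of_trivial, hMs.eq]
    · refine (hpos x hx).trans_eq ?_
      rw [← gram_vecMulVec, gram_apply, map_sum]
      simp only [map_sum, map_smul, smul_eq_mul, vecMulVec_apply, star_trivial, dotProduct, mulVec,
        Finset.mul_sum, hM, of_apply]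
      exact Finset.sum_congr rfl fun a _ => Finset.sum_congr rfl fun b _ => by ring
  obtain ⟨S, hS⟩ := exists_eq_transpose_mul_self hMp.posSemidef
  have hSdet : IsUnit S.det := by
    have h := (isUnit_iff_isUnit_det _).1 hMp.isUnit
    rw [hS, det_mul] at h
    exact isUnit_of_mul_isUnit_right h
  -- In the coordinates given by `S`, where the inner product of `M` is standard, this is
  -- multiplication by `x_j` compressed to words of length at most `L`.
  set X : Fin g → Matrix (Words g L) (Words g L) ℝ := fun j => (S⁻¹)ᵀ * N j * S⁻¹
  -- The compression has no effect while the length stays at most `L`.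
  have hword : ∀ (l : List (Fin g)) (hl : l.length ≤ L),
      evalOn X (word l) *ᵥ (S *ᵥ Pi.single (Words.nil g L) 1) = S *ᵥ Pi.single ⟨l, hl⟩ 1 := by
    intro l
    induction l with
    | nil => intro hl; simp [Words.nil]
    | cons j l ih =>
      intro hl
      have hl' : l.length ≤ L := by simp at hl; omega
      have hcol : N j *ᵥ Pi.single ⟨l, hl'⟩ 1 = M *ᵥ Pi.single ⟨j :: l, hl⟩ 1 := by
        ext a
        simp [hN, hM]
      rw [word_cons, map_mul, evalOn_ι, ← mulVec_mulVec, ih hl']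
      simp only [X, mulVec_mulVec]
      rw [Matrix.mul_assoc, nonsing_inv_mul _ hSdet, Matrix.mul_one, ← mulVec_mulVec, hcol, hS,
        mulVec_mulVec, ← Matrix.mul_assoc, ← transpose_mul, mul_nonsing_inv _ hSdet,
        transpose_one, Matrix.one_mul]
  refine ⟨X, S *ᵥ Pi.single (Words.nil g L) 1, fun j => ?_, fun q hq => ?_⟩
  · simp only [X, IsSymm, transpose_mul, transpose_transpose, (hNs j).eq, Matrix.mul_assoc]
  · conv_rhs => rw [← sum_coef_word q]
    rw [evalOn_eq_sum, sum_mulVec, dotProduct_sum, map_sum]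
    refine Finset.sum_congr rfl fun l hl => ?_
    have hl' := (length_le_degree (mem_supp.1 hl)).trans hq
    rw [smul_mulVec, dotProduct_smul, hword l hl', map_smul]
    congr 1
    rw [dotProduct_mulVec, ← mulVec_transpose, mulVec_mulVec, ← hS, hMs.symm]
    simp [hM, Words.nil]

/-- A symmetric free polynomial whose values at all tuples of symmetric matrices are positive
semidefinite is a sum of squares. -/
theorem isHermitianSOS_of_nonneg {f : Poly g} (hf : star f = f)
    (hpos : ∀ L, ∀ X : Fin g → Matrix (Words g L) (Words g L) ℝ, (∀ j, (X j).IsSymm) →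
      ∀ v, 0 ≤ v ⬝ᵥ evalOn X f *ᵥ v) : IsHermitianSOS f := by
  by_contra hsos
  -- About half the degree would do for the separation, but the tuple represents `Λ` only up to
  -- degree `L`.
  obtain ⟨Λ, hΛ, hΛf, hΛpos⟩ := exists_separating_functional hf hsos (L := degree f) (by omega)
  obtain ⟨X, v, hX, hv⟩ := exists_tuple_of_functional Λ hΛ hΛpos
  have h := hpos _ X hX v
  rw [hv f le_rfl] at h
  linarith

theorem IsQuasiConvex.alternative {p : Poly g} (hp : IsQuasiConvex p) :
    IsHermitianSOS (-p) ∨ (degree p ≤ 2 ∧ ∃ (l : Poly g) (m : ℕ) (s : Fin m → Poly g),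
      IsLinear l ∧ (∀ j, IsLinear (s j)) ∧ p = l + ∑ j, star (s j) * s j) := by
  by_cases h : ∃ (L : ℕ) (X : Fin g → Matrix (Words g L) (Words g L) ℝ) (v : Words g L → ℝ),
      (∀ j, (X j).IsSymm) ∧ 0 < v ⬝ᵥ evalOn X p *ᵥ v
  · obtain ⟨L, X, v, hX, hv⟩ := h
    exact Or.inr (hp.degree_le_two_and_eq hX hv)
  · push Not at h
    refine Or.inl (isHermitianSOS_of_nonneg (by rw [star_neg, hp.symmetric]) fun L X hX v => ?_)
    have := h L X v hX
    rw [map_neg, neg_mulVec, dotProduct_neg]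
    linarith

end FreePoly
end

/-! ### Invertibility of a nonzero polynomial at some symmetric tuple. -/

noncomputable section
namespace FreePoly
open Matrix Filter Topology
open scoped Kronecker
variable {g : ℕ}

section SignFamily

/-- A family of invertible matrices which are symmetric or skew-symmetric, commute or anticommute
pairwise, and span the full matrix algebra. -/
structure IsSignFamily {ι J : Type*} [Fintype ι] [DecidableEq ι] (P : J → Matrix ι ι ℝ) :
    Prop where
  transpose_eq : ∀ a, (P a)ᵀ = P a ∨ (P a)ᵀ = -P a
  comm : ∀ a b, P a * P b = P b * P a ∨ P a * P b = -(P b * P a)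
  isUnit : ∀ a, IsUnit (P a)
  span_eq_top : Submodule.span ℝ (Set.range P) = ⊤

variable {ι κ J K : Type*} [Fintype ι] [DecidableEq ι] [Fintype κ] [DecidableEq κ]

theorem IsSignFamily.kronecker {P : J → Matrix ι ι ℝ} {Q : K → Matrix κ κ ℝ}
    (hP : IsSignFamily P) (hQ : IsSignFamily Q) :
    IsSignFamily fun a : J × K => P a.1 ⊗ₖ Q a.2 where
  transpose_eq a := by
    rw [← kroneckerMap_transpose]
    rcases hP.transpose_eq a.1 with h1 | h1 <;> rcases hQ.transpose_eq a.2 with h2 | h2 <;>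
      rw [h1, h2]
    · exact Or.inl rfl
    · right; ext; simp
    · right; ext; simp
    · left; ext; simp
  comm a b := by
    rw [← mul_kronecker_mul, ← mul_kronecker_mul]
    rcases hP.comm a.1 b.1 with h1 | h1 <;> rcases hQ.comm a.2 b.2 with h2 | h2 <;>
      rw [h1, h2]
    · exact Or.inl rfl
    · right; ext; simp
    · right; ext; simp
    · left; ext; simp
  isUnit a := by
    obtain ⟨u, hu⟩ := hP.isUnit a.1
    obtain ⟨w, hw⟩ := hQ.isUnit a.2
    refine IsUnit.of_mul_eq_one (u⁻¹.val ⊗ₖ w⁻¹.val) ?_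
    rw [← mul_kronecker_mul, ← hu, ← hw]
    simp
  span_eq_top := by
    have h := Submodule.map₂_span_span ℝ (kroneckerBilinear (R := ℝ) (α := ℝ)
      : Matrix ι ι ℝ →ₗ[ℝ] Matrix κ κ ℝ →ₗ[ℝ] _) (Set.range P) (Set.range Q)
    rw [hP.span_eq_top, hQ.span_eq_top, Set.image2_range] at h
    rw [eq_top_iff]
    intro M _
    have h2 : M ∈ Submodule.map₂ (kroneckerBilinear (R := ℝ) (α := ℝ)
      : Matrix ι ι ℝ →ₗ[ℝ] Matrix κ κ ℝ →ₗ[ℝ] _) ⊤ ⊤ := by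
      rw [matrix_eq_sum_single M]
      refine Submodule.sum_mem _ fun i _ => Submodule.sum_mem _ fun j _ => ?_
      have h3 : single i j (M i j) = single i.1 j.1 (M i j) ⊗ₖ single i.2 j.2 (1 : ℝ) := by
        rw [single_kronecker_single, mul_one]
      rw [h3]
      exact Submodule.apply_mem_map₂ _ Submodule.mem_top Submodule.mem_top
    rw [h] at h2
    exact h2

/-- The real Pauli matrices. -/
def pauli : Fin 4 → Matrix (Fin 2) (Fin 2) ℝ :=
  ![1, !![1, 0; 0, -1], !![0, 1; 1, 0], !![0, 1; -1, 0]]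

theorem isSignFamily_pauli : IsSignFamily pauli where
  transpose_eq a := by
    fin_cases a
    · left; simp [pauli]
    · left; ext i j; fin_cases i <;> fin_cases j <;> simp [pauli]
    · left; ext i j; fin_cases i <;> fin_cases j <;> simp [pauli]
    · right; ext i j; fin_cases i <;> fin_cases j <;> simp [pauli]
  comm a b := by
    fin_cases a <;> fin_cases b <;> simp [pauli, ← Matrix.ext_iff]
  isUnit a := by
    rw [isUnit_iff_isUnit_det]
    fin_cases a <;> simp [pauli, det_fin_two]
  span_eq_top := by
    rw [eq_top_iff]
    intro M _
    have hM : M = ((M 0 0 + M 1 1) / 2) • pauli 0 + ((M 0 0 - M 1 1) / 2) • pauli 1 +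
        ((M 0 1 + M 1 0) / 2) • pauli 2 + ((M 0 1 - M 1 0) / 2) • pauli 3 := by
      ext i j
      fin_cases i <;> fin_cases j <;> simp [pauli] <;> ring
    rw [hM]
    have hmem : ∀ a, pauli a ∈ Submodule.span ℝ (Set.range pauli) := fun a =>
      Submodule.subset_span ⟨a, rfl⟩
    exact add_mem (add_mem (add_mem (Submodule.smul_mem _ _ (hmem 0))
      (Submodule.smul_mem _ _ (hmem 1))) (Submodule.smul_mem _ _ (hmem 2)))
      (Submodule.smul_mem _ _ (hmem 3))

theorem exists_isSignFamily (k : ℕ) :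
    ∃ (ι J : Type) (_ : Fintype ι) (_ : DecidableEq ι) (_ : Fintype J) (P : J → Matrix ι ι ℝ),
      IsSignFamily P ∧ k ≤ Fintype.card ι := by
  suffices ∃ (ι J : Type) (_ : Fintype ι) (_ : DecidableEq ι) (_ : Fintype J)
      (P : J → Matrix ι ι ℝ), IsSignFamily P ∧ Fintype.card ι = 2 ^ (k + 1) by
    obtain ⟨ι, J, _, _, _, P, hP, hc⟩ := this
    exact ⟨ι, J, inferInstance, inferInstance, inferInstance, P, hP, by rw [hc]; exact (k.lt_succ_self.trans Nat.lt_two_pow_self).le⟩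
  induction k with
  | zero => exact ⟨Fin 2, Fin 4, inferInstance, inferInstance, inferInstance, pauli, isSignFamily_pauli, rfl⟩
  | succ k ih =>
    obtain ⟨ι, J, _, _, _, P, hP, hc⟩ := ih
    exact ⟨ι × Fin 2, J × Fin 4, _, _, inferInstance, _, hP.kronecker isSignFamily_pauli, by
      rw [Fintype.card_prod, hc, Fintype.card_fin, ← pow_succ]⟩

/-- A symmetric matrix is a linear combination of the symmetric members of a sign family. -/
theorem IsSignFamily.exists_sum_eq [Fintype J] {P : J → Matrix ι ι ℝ} (hP : IsSignFamily P)
    {M : Matrix ι ι ℝ} (hM : M.IsSymm) :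
    ∃ c : J → ℝ, (∀ a, c a = 0 ∨ (P a).IsSymm) ∧ M = ∑ a, c a • P a := by
  classical
  have hmem : M ∈ Submodule.span ℝ (Set.range P) := by rw [hP.span_eq_top]; trivial
  obtain ⟨c, hc⟩ := (Submodule.mem_span_range_iff_exists_fun ℝ).1 hmem
  refine ⟨fun a => if (P a).IsSymm then c a else 0, fun a => ?_, ?_⟩
  · by_cases h : (P a).IsSymm <;> simp [h]
  · have h1 : M = (1 / 2 : ℝ) • (M + Mᵀ) := by
      rw [hM.eq, ← two_smul ℝ M, smul_smul]
      norm_num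
    rw [h1, ← hc, transpose_sum, ← Finset.sum_add_distrib, Finset.smul_sum]
    refine Finset.sum_congr rfl fun a _ => ?_
    rw [transpose_smul]
    beta_reduce
    by_cases h : (P a).IsSymm
    · rw [if_pos h, h.eq, ← two_smul ℝ (c a • P a), smul_smul]
      norm_num
    · rw [if_neg h, (hP.transpose_eq a).resolve_left h]
      simp

variable {P : J → Matrix ι ι ℝ}

/-- Up to sign, noncommutative words in the family collapse to commutative monomials. -/
theorem IsSignFamily.prod_perm (hP : IsSignFamily P) {l m : List J} (h : l.Perm m) :
    (l.map P).prod = (m.map P).prod ∨ (l.map P).prod = -(m.map P).prod := by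
  induction h with
  | nil => exact Or.inl rfl
  | cons a _ ih => rcases ih with ih | ih <;> simp [ih]
  | swap a b l =>
    rcases hP.comm b a with h | h <;> simp [← mul_assoc, h]
  | trans _ _ ih1 ih2 => rcases ih1 with ih1 | ih1 <;> rcases ih2 with ih2 | ih2 <;> simp [ih1, ih2]

/-- The product of a multiset of members of a family, in an arbitrarily chosen order. -/
def multisetProd (P : J → Matrix ι ι ℝ) (γ : Multiset J) : Matrix ι ι ℝ := (γ.toList.map P).prod

theorem IsSignFamily.isUnit_multisetProd (hP : IsSignFamily P) (γ : Multiset J) :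
    IsUnit (multisetProd P γ) := by
  rw [multisetProd]
  refine Submonoid.list_prod_mem (IsUnit.submonoid _) fun M hM => ?_
  obtain ⟨a, -, rfl⟩ := List.mem_map.1 hM
  exact hP.isUnit a

theorem IsSignFamily.mul_multisetProd (hP : IsSignFamily P) (a : J) (γ : Multiset J) :
    ∃ s : ℝ, P a * multisetProd P γ = s • multisetProd P (a ::ₘ γ) := by
  have hperm : (a :: γ.toList).Perm (a ::ₘ γ).toList := by
    rw [← Multiset.coe_eq_coe, ← Multiset.cons_coe, Multiset.coe_toList, Multiset.coe_toList]
  rcases hP.prod_perm hperm with h | h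
  · exact ⟨1, by simpa [multisetProd] using h⟩
  · exact ⟨-1, by simpa [multisetProd] using h⟩

/-- The tuple with coordinates `c` in a family, the member `a` being scaled by `t a`. -/
def scaledTuple [Fintype J] (P : J → Matrix ι ι ℝ) (c : Fin g → J → ℝ) (t : J → ℝ) :
    Fin g → Matrix ι ι ℝ :=
  fun j => ∑ a, (c j a * t a) • P a

/-- The evaluation is a polynomial in the commuting parameters `t`, each monomial carrying a
multiple of a single invertible matrix. -/
theorem IsSignFamily.evalOn_mem_span [Fintype J] (hP : IsSignFamily P) (c : Fin g → J → ℝ)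
    (h : Poly g) :
    (fun t => evalOn (scaledTuple P c t) h) ∈ Submodule.span ℝ
      (Set.range fun (γ : Multiset J) (t : J → ℝ) => (γ.map t).prod • multisetProd P γ) := by
  set V := Submodule.span ℝ
    (Set.range fun (γ : Multiset J) (t : J → ℝ) => (γ.map t).prod • multisetProd P γ)
  have hword : ∀ l : List (Fin g), (fun t => evalOn (scaledTuple P c t) (word l)) ∈ V := by
    intro l
    induction l with
    | nil =>
      refine Submodule.subset_span ⟨0, ?_⟩
      simp [multisetProd]
    | cons j l ih =>
      have hstep : ∀ F ∈ V, (fun t => scaledTuple P c t j * F t) ∈ V := by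
        intro F hF
        induction hF using Submodule.span_induction with
        | mem F hF =>
          obtain ⟨γ, rfl⟩ := hF
          choose s hs using fun a => hP.mul_multisetProd a γ
          have heq : (fun t => scaledTuple P c t j * (γ.map t).prod • multisetProd P γ) =
              ∑ a, (c j a * s a) • fun t : J → ℝ =>
                ((a ::ₘ γ).map t).prod • multisetProd P (a ::ₘ γ) := by
            funext t
            simp only [scaledTuple, Finset.sum_mul, Finset.sum_apply, Pi.smul_apply,
              Multiset.map_cons, Multiset.prod_cons]
            refine Finset.sum_congr rfl fun a _ => ?_
            rw [smul_mul_smul_comm, hs a, smul_smul, smul_smul]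
            congr 1
            ring
          rw [heq]
          exact Submodule.sum_mem _ fun a _ =>
            Submodule.smul_mem _ _ (Submodule.subset_span ⟨a ::ₘ γ, rfl⟩)
        | zero =>
          simp only [Pi.zero_apply, mul_zero]
          exact V.zero_mem
        | add F G _ _ hF hG =>
          simp only [Pi.add_apply, mul_add]
          exact V.add_mem hF hG
        | smul r F _ hF =>
          simp only [Pi.smul_apply, mul_smul_comm]
          exact V.smul_mem r hF
      simp only [word_cons, map_mul, evalOn_ι]
      exact hstep _ ih
  have heq : (fun t => evalOn (scaledTuple P c t) h) =
      ∑ l ∈ supp h, coef l h • fun t => evalOn (scaledTuple P c t) (word l) := by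
    funext t
    rw [evalOn_eq_sum]
    simp
  rw [heq]
  exact Submodule.sum_mem _ fun l _ => Submodule.smul_mem _ _ (hword l)

/-- Powers of `B` read multiplicities as base-`B` digits, `B` exceeding every multiplicity in `s`.
-/
theorem exists_weight_injOn [Fintype J] (s : Finset (Multiset J)) :
    ∃ W : J → ℕ, Set.InjOn (fun γ : Multiset J => (γ.map W).sum) s := by
  classical
  set B := s.sup Multiset.card + 1
  set e := Fintype.equivFin J
  refine ⟨fun a => B ^ (e a : ℕ), ?_⟩
  have hcount : ∀ γ ∈ s, ∀ a, γ.count a < B := fun γ hγ a =>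
    Nat.lt_succ_of_le ((γ.count_le_card a).trans (Finset.le_sup (f := Multiset.card) hγ))
  have hsum : ∀ γ (hγ : γ ∈ s), (γ.map fun a => B ^ (e a : ℕ)).sum =
      (finFunctionFinEquiv fun i => (⟨γ.count (e.symm i), hcount γ hγ _⟩ : Fin B) : ℕ) := by
    intro γ hγ
    rw [finFunctionFinEquiv_apply, Finset.sum_multiset_map_count,
      Finset.sum_subset (Finset.subset_univ _), ← e.symm.sum_comp]
    · simp
    · intro a _ ha
      rw [Multiset.mem_toFinset] at ha
      simp [ha]
  intro γ hγ δ hδ h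
  simp only at h
  rw [hsum γ hγ, hsum δ hδ] at h
  have h2 := finFunctionFinEquiv.injective (Fin.ext h)
  ext a
  simpa using congrArg Fin.val (congrFun h2 (e a))

/-- If `h` does not vanish at a tuple of combinations of members of a sign family, then `h` is
invertible at a suitable rescaling of this tuple. -/
theorem IsSignFamily.exists_isUnit_evalOn [Fintype J] (hP : IsSignFamily P) (c : Fin g → J → ℝ)
    {h : Poly g} (hne : evalOn (scaledTuple P c fun _ => 1) h ≠ 0) :
    ∃ t : J → ℝ, IsUnit (evalOn (scaledTuple P c t) h) := by
  obtain ⟨C, hC⟩ := Finsupp.mem_span_range_iff_exists_finsupp.1 (hP.evalOn_mem_span c h)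
  have hC' : ∀ t : J → ℝ, evalOn (scaledTuple P c t) h =
      ∑ γ ∈ C.support, (C γ * (γ.map t).prod) • multisetProd P γ := by
    intro t
    rw [← congrFun hC t, Finsupp.sum, Finset.sum_apply]
    simp [smul_smul]
  have hsupp : C.support.Nonempty := by
    rw [Finset.nonempty_iff_ne_empty]
    intro h0
    exact hne (by rw [hC', h0, Finset.sum_empty])
  obtain ⟨W, hW⟩ := exists_weight_injOn C.support
  -- Along `t a = τ ^ W a` distinct monomials grow at distinct rates; after division by the largest
  -- power only the invertible term of `γ₀` survives as `τ → ∞`.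
  obtain ⟨γ₀, hγ₀, hmax⟩ := Finset.exists_max_image C.support (fun γ => (γ.map W).sum) hsupp
  set w : Multiset J → ℕ := fun γ => (γ.map W).sum
  have hprod : ∀ (τ : ℝ) (γ : Multiset J), (γ.map fun a => τ ^ W a).prod = τ ^ w γ := by
    intro τ γ
    simp only [w]
    induction γ using Multiset.induction with
    | empty => simp
    | cons a γ ih => simp [ih, pow_add]
  have hlim : Tendsto (fun τ : ℝ => ∑ γ ∈ C.support, (C γ * τ⁻¹ ^ (w γ₀ - w γ)) • multisetProd P γ)
      atTop (𝓝 (∑ γ ∈ C.support, (C γ * (0 : ℝ) ^ (w γ₀ - w γ)) • multisetProd P γ)) :=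
    tendsto_finsetSum _ fun γ _ =>
      (((tendsto_inv_atTop_zero.pow _).const_mul _).smul_const _)
  have hval : ∑ γ ∈ C.support, (C γ * (0 : ℝ) ^ (w γ₀ - w γ)) • multisetProd P γ =
      C γ₀ • multisetProd P γ₀ := by
    rw [Finset.sum_eq_single γ₀]
    · simp
    · intro γ hγ hne
      have : w γ ≠ w γ₀ := fun h => hne (hW hγ hγ₀ h)
      have := hmax γ hγ
      rw [zero_pow (by simp only [w] at *; omega), mul_zero, zero_smul]
    · exact fun h => absurd hγ₀ h
  rw [hval] at hlim
  have hdet : (C γ₀ • multisetProd P γ₀).det ≠ 0 := by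
    rw [det_smul]
    exact mul_ne_zero (pow_ne_zero _ (Finsupp.mem_support_iff.1 hγ₀))
      ((isUnit_iff_isUnit_det _).1 (hP.isUnit_multisetProd γ₀)).ne_zero
  have hdetlim := ((Continuous.matrix_det continuous_id).tendsto _).comp hlim
  obtain ⟨τ, hτ, hτ0⟩ := ((hdetlim.eventually_ne hdet).and (eventually_gt_atTop 0)).exists
  refine ⟨fun a => τ ^ W a, (isUnit_iff_isUnit_det _).2 ?_⟩
  have heq : evalOn (scaledTuple P c fun a => τ ^ W a) h = τ ^ w γ₀ •
      ∑ γ ∈ C.support, (C γ * τ⁻¹ ^ (w γ₀ - w γ)) • multisetProd P γ := by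
    rw [hC', Finset.smul_sum]
    refine Finset.sum_congr rfl fun γ hγ => ?_
    rw [hprod, smul_smul]
    congr 1
    obtain ⟨k, hk⟩ := Nat.exists_eq_add_of_le (hmax γ hγ)
    have hk' : w γ₀ = w γ + k := hk
    rw [hk', Nat.add_sub_cancel_left, pow_add, inv_pow]
    field_simp
  rw [heq, det_smul]
  exact IsUnit.mk0 _ (mul_ne_zero (pow_ne_zero _ (pow_ne_zero _ hτ0.ne')) hτ)

end SignFamily

/-- A nonzero free polynomial is invertible at some tuple of symmetric matrices. -/
theorem exists_isUnit_evalOn {h : Poly g} (hh : h ≠ 0) :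
    ∃ (ι : Type) (_ : Fintype ι) (_ : DecidableEq ι) (X : Fin g → Matrix ι ι ℝ),
      Nonempty ι ∧ (∀ j, (X j).IsSymm) ∧ IsUnit (evalOn X h) := by
  set L := degree h
  obtain ⟨ι, J, _, _, _, P, hP, hcard⟩ := exists_isSignFamily (Fintype.card (Words g L))
  obtain ⟨m, hm⟩ := Nat.exists_eq_add_of_le hcard
  have e : Words g L ⊕ Fin m ≃ ι := Fintype.equivOfCardEq (by simp [hm])
  -- Zero padding brings the Fock tuple to the size of the sign family, in whose symmetric members
  -- it can be expanded.
  set Y := directSum (fock g L) (0 : Fin g → Matrix (Fin m) (Fin m) ℝ)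
  have hY : ∀ j, (Y j).IsSymm := directSum_isSymm (fock_isSymm g L) fun j => by simp [IsSymm]
  have hfock : evalOn (fock g L) h ≠ 0 := fun h0 =>
    fock_mulVec_vacuum_ne_zero hh le_rfl (by rw [h0, zero_mulVec])
  have hYne : evalOn (fun j => (Y j).submatrix e.symm e.symm) h ≠ 0 := by
    rw [← reindex_evalOn, evalOn_directSum]
    intro h0
    refine hfock ?_
    ext a b
    simpa using congrFun (congrFun h0 (e (Sum.inl a))) (e (Sum.inl b))
  choose c hc hYc using fun j => hP.exists_sum_eq ((hY j).submatrix e.symm)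
  have hY1 : (fun j => (Y j).submatrix e.symm e.symm) = scaledTuple P c fun _ => 1 := by
    funext j
    simp only [scaledTuple, mul_one]
    exact hYc j
  rw [hY1] at hYne
  obtain ⟨t, ht⟩ := hP.exists_isUnit_evalOn c hYne
  refine ⟨ι, _, _, scaledTuple P c t, ?_, fun j => ?_, ht⟩
  · by_contra hemp
    rw [not_nonempty_iff] at hemp
    exact hYne (Subsingleton.elim _ _)
  · simp only [scaledTuple, IsSymm, transpose_sum, transpose_smul]
    refine Finset.sum_congr rfl fun a _ => ?_
    rcases hc j a with h | h
    · simp [h]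
    · rw [h.eq]

end FreePoly
end

/-! ### Leading terms at infinity and the second claim. -/

noncomputable section
namespace FreePoly
open Matrix Filter Topology
variable {g : ℕ} {ι κ : Type*} [Fintype ι] [DecidableEq ι] [Fintype κ] [DecidableEq κ]

omit [DecidableEq ι] in
theorem abs_dotProduct_mulVec_le (M : Matrix ι ι ℝ) (x : ι → ℝ) :
    |x ⬝ᵥ M *ᵥ x| ≤ (∑ i, ∑ j, |M i j|) * (x ⬝ᵥ x) := by
  have hx : ∀ i, x i * x i ≤ x ⬝ᵥ x := fun i =>
    Finset.single_le_sum (f := fun i => x i * x i) (fun _ _ => mul_self_nonneg _)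
      (Finset.mem_univ i)
  have hxy : ∀ i j, |x i| * |x j| ≤ x ⬝ᵥ x := fun i j => by
    have := hx i
    have := hx j
    nlinarith [sq_nonneg (|x i| - |x j|), abs_mul_abs_self (x i), abs_mul_abs_self (x j)]
  simp only [Finset.sum_mul]
  rw [dotProduct]
  refine (Finset.abs_sum_le_sum_abs _ _).trans (Finset.sum_le_sum fun i _ => ?_)
  rw [mulVec, dotProduct, Finset.mul_sum]
  refine (Finset.abs_sum_le_sum_abs _ _).trans (Finset.sum_le_sum fun j _ => ?_)
  rw [abs_mul, abs_mul]
  calc |x i| * (|M i j| * |x j|) = |M i j| * (|x i| * |x j|) := by ring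
    _ ≤ |M i j| * (x ⬝ᵥ x) := mul_le_mul_of_nonneg_left (hxy i j) (abs_nonneg _)

/-- Invertibility of `R` gives `‖x‖² ≤ C ⟨x, G 0 x⟩`; near `0` the perturbation `G s - G 0`,
multiplied by `C`, is smaller than `1`. -/
theorem eventually_posDef {G : ℝ → Matrix ι ι ℝ} (hG : Continuous G)
    (hs : ∀ s, (G s).IsSymm) {R : Matrix ι ι ℝ} (hR : IsUnit R) (h0 : G 0 = Rᵀ * R) :
    ∀ᶠ s in 𝓝 0, (G s).PosDef := by
  obtain ⟨C, hC, hb⟩ := exists_dotProduct_mulVec_le (R⁻¹ᵀ * R⁻¹)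
  have hRdet := (isUnit_iff_isUnit_det _).1 hR
  have hlow : ∀ x : ι → ℝ, x ⬝ᵥ x ≤ C * (x ⬝ᵥ G 0 *ᵥ x) := by
    intro x
    have h1 := (le_abs_self _).trans (hb (R *ᵥ x) (R *ᵥ x))
    rw [Real.mul_self_sqrt (zero_le_dotProduct_self _)] at h1
    have h2 : (R *ᵥ x) ⬝ᵥ (R⁻¹ᵀ * R⁻¹) *ᵥ (R *ᵥ x) = x ⬝ᵥ x := by
      rw [← mulVec_mulVec, dotProduct_mulVec, vecMul_transpose, mulVec_mulVec,
        nonsing_inv_mul _ hRdet, one_mulVec]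
    have h3 : (R *ᵥ x) ⬝ᵥ (R *ᵥ x) = x ⬝ᵥ G 0 *ᵥ x := by
      rw [h0, ← mulVec_mulVec, dotProduct_mulVec x, vecMul_transpose]
    rwa [h2, h3] at h1
  have hc : Continuous fun s => C * ∑ i, ∑ j, |(G s - G 0) i j| := by
    refine continuous_const.mul (continuous_finsetSum _ fun i _ => continuous_finsetSum _
      fun j _ => Continuous.abs ?_)
    exact (hG.sub continuous_const).matrix_elem i j
  have hev := hc.continuousAt.eventually_lt (x₀ := (0 : ℝ)) (g := fun _ => (1 : ℝ))
    continuousAt_const (by simp)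
  filter_upwards [hev] with s hs1
  refine PosDef.of_dotProduct_mulVec_pos ?_ fun x hx => ?_
  · rw [IsHermitian, conjTranspose_eq_transpose_of_trivial, (hs s).eq]
  · have hxx : 0 < x ⬝ᵥ x :=
      lt_of_le_of_ne (zero_le_dotProduct_self x) (Ne.symm (by simpa using hx))
    have h1 := (abs_le.1 (abs_dotProduct_mulVec_le (G s - G 0) x)).1
    rw [sub_mulVec, dotProduct_sub] at h1
    rw [star_trivial]
    set E := ∑ i, ∑ j, |(G s - G 0) i j|
    have h2 := hlow x
    by_contra! hneg
    nlinarith [mul_le_mul_of_nonneg_left h1 hC]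

theorem evalOn_smul_word (t : ℝ) (X : Fin g → Matrix ι ι ℝ) (l : List (Fin g)) :
    evalOn (t • X) (word l) = t ^ l.length • evalOn X (word l) := by
  induction l with
  | nil => simp
  | cons j l ih => simp [ih, pow_succ, smul_smul]

/-- The homogeneous component of degree `d`. -/
def homogeneousPart (d : ℕ) (h : Poly g) : Poly g :=
  ∑ l ∈ supp h with l.length = d, coef l h • word l

theorem coef_homogeneousPart (d : ℕ) (h : Poly g) {l : List (Fin g)} (hl : l.length = d) :
    coef l (homogeneousPart d h) = coef l h := by
  simp only [homogeneousPart, map_sum, map_smul, coef_word, smul_eq_mul, mul_ite, mul_one,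
    mul_zero, Finset.sum_ite_eq, Finset.mem_filter, hl, and_true]
  split_ifs with h'
  · rfl
  · rw [mem_supp, not_not] at h'
    exact h'.symm

/-- With `d` the degree, `s^d h(X/s)` is a polynomial in `s` whose constant term is the leading part
of `h` at `X`. -/
theorem exists_scaled_evalOn (X : Fin g → Matrix ι ι ℝ) (h : Poly g) :
    ∃ R : ℝ → Matrix ι ι ℝ, Continuous R ∧ R 0 = evalOn X (homogeneousPart (degree h) h) ∧
      ∀ s : ℝ, s ≠ 0 → R s = s ^ degree h • evalOn (s⁻¹ • X) h := by
  refine ⟨fun s => ∑ l ∈ supp h, (s ^ (degree h - l.length)) • coef l h • evalOn X (word l),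
    ?_, ?_, fun s hs => ?_⟩
  · exact continuous_finsetSum _ fun l _ => (continuous_id.pow _).smul continuous_const
  · simp only [homogeneousPart, map_sum, Finset.sum_filter]
    refine Finset.sum_congr rfl fun l hl => ?_
    have := length_le_degree (mem_supp.1 hl)
    split_ifs with hd
    · simp [hd]
    · rw [zero_pow (by omega), zero_smul, map_zero]
  · rw [evalOn_eq_sum, Finset.smul_sum]
    refine Finset.sum_congr rfl fun l hl => ?_
    obtain ⟨k, hk⟩ := Nat.exists_eq_add_of_le (length_le_degree (mem_supp.1 hl))
    rw [evalOn_smul_word, smul_smul, smul_smul, smul_smul, hk, Nat.add_sub_cancel_left, pow_add,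
      inv_pow]
    congr 1
    field_simp

/-- The sum of a family of hermitian squares dominates any given matrix at large multiples of a
tuple at which the leading part of one member is invertible. -/
theorem eventually_posDef_add_squares {m : ℕ} (h : Fin m → Poly g) (k : Fin m)
    (hd : 0 < degree (h k)) {X : Fin g → Matrix ι ι ℝ} (hX : ∀ j, (X j).IsSymm)
    (hu : IsUnit (evalOn X (homogeneousPart (degree (h k)) (h k)))) {B : Matrix ι ι ℝ}
    (hB : B.IsSymm) :
    ∀ᶠ s : ℝ in 𝓝 0, s ≠ 0 → (B + evalOn (s⁻¹ • X) (∑ j, star (h j) * h j)).PosDef := by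
  obtain ⟨R, hRc, hR0, hR⟩ := exists_scaled_evalOn X (h k)
  set d := degree (h k)
  -- The factor `s^(2d)` removes `B` at `s = 0`, since `d > 0`, and leaves the square of the leading
  -- part. Being even, it also covers negative `s`.
  have hGc : Continuous fun s : ℝ => s ^ (2 * d) • B + (R s)ᵀ * R s :=
    ((continuous_id.pow _).smul continuous_const).add (hRc.matrix_transpose.matrix_mul hRc)
  have hev := eventually_posDef hGc (fun s => by
    simp [IsSymm, hB.eq, transpose_mul]) hu (by simp [hd.ne', hR0])
  filter_upwards [hev] with s hs hs0
  have hsX : ∀ j, ((s⁻¹ • X) j).IsSymm := fun j => IsSymm.smul (hX j) s⁻¹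
  have hsq : ∀ j, evalOn (s⁻¹ • X) (star (h j) * h j) =
      (evalOn (s⁻¹ • X) (h j))ᵀ * evalOn (s⁻¹ • X) (h j) := fun j => by
    rw [map_mul, evalOn_star hsX]
  have h2d : 0 < s ^ (2 * d) := by
    rw [pow_mul]
    positivity
  have h1 : (B + evalOn (s⁻¹ • X) (star (h k) * h k)).PosDef := by
    have h3 := hs.smul (inv_pos.2 h2d)
    rw [hR s hs0, transpose_smul, smul_mul_smul_comm, ← hsq, ← pow_add, ← two_mul, ← smul_add,
      inv_smul_smul₀ h2d.ne'] at h3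
    exact h3
  rw [← Finset.add_sum_erase _ _ (Finset.mem_univ k), map_add, ← add_assoc, map_sum]
  refine h1.add_posSemidef (posSemidef_sum _ fun j _ => ?_)
  rw [hsq, ← conjTranspose_eq_transpose_of_trivial]
  exact posSemidef_conjTranspose_mul_self _

/-- Block diagonal repetition, as an algebra homomorphism. -/
def ampliation (ι κ : Type*) [Fintype ι] [DecidableEq ι] [Fintype κ] [DecidableEq κ] :
    Matrix ι ι ℝ →ₐ[ℝ] Matrix (ι × κ) (ι × κ) ℝ where
  toFun M := blockDiagonal fun _ => M
  map_one' := blockDiagonal_one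
  map_mul' M N := blockDiagonal_mul (fun _ => M) fun _ => N
  map_zero' := blockDiagonal_zero
  map_add' M N := blockDiagonal_add (fun _ => M) fun _ => N
  commutes' r := by
    simp only [Algebra.algebraMap_eq_smul_one]
    rw [← blockDiagonal_one, ← blockDiagonal_smul]
    rfl

theorem eq_zero_of_sum_squares_of_degree_eq_zero {m : ℕ} {h : Fin m → Poly g} {p : Poly g}
    (hp0 : coef [] p = 0) (hp : -p = ∑ j, star (h j) * h j) (hd : ∀ j, degree (h j) = 0) :
    p = 0 := by
  have hconst : ∀ j, h j = coef [] (h j) • (1 : Poly g) := by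
    intro j
    refine poly_ext fun l => ?_
    rw [map_smul, ← word_nil, coef_word]
    split_ifs with hl
    · simp [hl]
    · rw [smul_zero]
      exact coef_eq_zero_of_degree_lt (by rw [hd j]; exact List.length_pos_iff.2 hl)
  have hsum : -p = (∑ j, coef [] (h j) * coef [] (h j)) • (1 : Poly g) := by
    rw [hp, Finset.sum_smul]
    refine Finset.sum_congr rfl fun j _ => ?_
    conv_lhs => rw [hconst j]
    rw [star_smul_poly, star_one, smul_mul_smul_comm, mul_one]
  have h0 := congrArg (coef []) hsum
  rw [map_neg, hp0, map_smul, ← word_nil, coef_word, if_pos rfl, smul_eq_mul, mul_one,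
    neg_zero] at h0
  rw [← h0, zero_smul] at hsum
  exact neg_eq_zero.1 hsum

/-- A nonconstant square puts both `Y/s` and `-Y/s` in the level set of `B` for small `s`, hence
also their midpoint `0`, where positivity would be that of `B`. -/
theorem eq_zero_of_convex_levelSet {p : Poly g} (hp : IsQuasiConvex p)
    (hB : ∃ N : ℕ, ∀ n : ℕ, N ≤ n → ∃ B : Matrix (Fin n) (Fin n) ℝ,
      B.IsSymm ∧ ¬ B.PosSemidef ∧ Convex ℝ (levelSet p B))
    (hsos : IsHermitianSOS (-p)) : p = 0 := by
  obtain ⟨N, hN⟩ := hB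
  obtain ⟨m, h, hh⟩ := hsos
  by_contra hp0
  obtain ⟨k, hk⟩ : ∃ k, 0 < degree (h k) := by
    by_contra! hd
    exact hp0 (eq_zero_of_sum_squares_of_degree_eq_zero hp.coef_nil hh fun j =>
      Nat.le_zero.1 (hd j))
  have htop : homogeneousPart (degree (h k)) (h k) ≠ 0 := by
    obtain ⟨l, hl, hlen⟩ := exists_coef_ne_zero_of_degree_pos hk
    intro h0
    rw [← coef_homogeneousPart _ _ hlen, h0, map_zero] at hl
    exact hl rfl
  obtain ⟨ι, _, _, X, hne, hX, hu⟩ := exists_isUnit_evalOn htop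
  -- As `ι` is nonempty, `N + 1` copies of the tuple reach a size at least `N`.
  set e := Fintype.equivFin (ι × Fin (N + 1))
  set n := Fintype.card (ι × Fin (N + 1))
  have hn : N ≤ n := by
    simp only [n, Fintype.card_prod, Fintype.card_fin]
    have := Fintype.card_pos (α := ι)
    nlinarith
  obtain ⟨B, hBs, hBn, hBc⟩ := hN n hn
  set ψ : Matrix ι ι ℝ →ₐ[ℝ] Matrix (Fin n) (Fin n) ℝ :=
    (reindexAlgEquiv ℝ ℝ e).toAlgHom.comp (ampliation ι (Fin (N + 1)))
  set Y : Fin g → Matrix (Fin n) (Fin n) ℝ := fun j => ψ (X j)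
  have hY : ∀ j, (Y j).IsSymm := by
    intro j
    have : (ampliation ι (Fin (N + 1)) (X j)).IsSymm := by
      simp [ampliation, IsSymm, blockDiagonal_transpose, (hX j).eq]
    exact this.submatrix _
  have huY : IsUnit (evalOn Y (homogeneousPart (degree (h k)) (h k))) := by
    rw [← map_evalOn ψ]
    exact hu.map ψ
  have hev := eventually_posDef_add_squares h k hk hY huY hBs
  obtain ⟨δ, hδ, hball⟩ := Metric.eventually_nhds_iff.1 hev
  have hmem : ∀ s : ℝ, s ≠ 0 → |s| < δ → s⁻¹ • Y ∈ levelSet p B := by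
    intro s hs hsδ
    refine ⟨fun j => IsSymm.smul (hY j) s⁻¹, ?_⟩
    have := hball (y := s) (by simpa using hsδ) hs
    rwa [← hh, map_neg, ← sub_eq_add_neg] at this
  have hmid := hBc (hmem (δ / 2) (by positivity) (by rw [abs_of_pos (by positivity)]; linarith))
    (hmem (-(δ / 2)) (neg_ne_zero.2 (by positivity))
      (by rw [abs_neg, abs_of_pos (by positivity)]; linarith))
    (a := 1 / 2) (b := 1 / 2) (by norm_num) (by norm_num) (by norm_num)
  have hzero : (1 / 2 : ℝ) • (δ / 2)⁻¹ • Y + (1 / 2 : ℝ) • (-(δ / 2))⁻¹ • Y = 0 := by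
    rw [inv_neg, neg_smul, smul_neg, add_neg_cancel]
  rw [hzero] at hmid
  have hpd := hmid.2
  rw [hp.eval_zero, sub_zero] at hpd
  exact hBn hpd.posSemidef

end FreePoly
end

theorem theorem1p1 (g : ℕ) (p : FreePoly.Poly g) (hp : FreePoly.IsQuasiConvex p) :
    (FreePoly.IsHermitianSOS (-p) ∨
      (FreePoly.degree p ≤ 2 ∧
        ∃ (l : FreePoly.Poly g) (m : ℕ) (s : Fin m → FreePoly.Poly g),
          FreePoly.IsLinear l ∧ (∀ j, FreePoly.IsLinear (s j)) ∧
            p = l + ∑ j, star (s j) * s j)) ∧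
    ((∃ N : ℕ, ∀ n : ℕ, N ≤ n →
        ∃ B : Matrix (Fin n) (Fin n) ℝ,
          B.IsSymm ∧ ¬ B.PosSemidef ∧ Convex ℝ (FreePoly.levelSet p B)) →
      (FreePoly.IsHermitianSOS (-p) ↔ p = 0)) := by
  refine ⟨hp.alternative, fun hB => ⟨FreePoly.eq_zero_of_convex_levelSet hp hB, ?_⟩⟩
  rintro rfl
  exact ⟨0, Fin.elim0, by simp⟩
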